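/- Fix the alphabet $\Sigma=\{0,1\}$. For a generator $f:\Sigma^*\to\Sigma$ put $\bar f(x)=\mathrm{append}(x,f(x))$, let $f^{\mathrm{CoT}\text{-}T}=\bar f\circ\dots\circ\bar f$ ($T$ times) and let $f^{\mathrm{e2e}\text{-}T}(x)$ be the last token of $f^{\mathrm{CoT}\text{-}T}(x)$, $T\ge 1$. For a class $\mathcal F\subseteq\Sigma^{\Sigma^*}$, the class $\mathrm{e2e}^T(\mathcal F)=\{f^{\mathrm{e2e}\text{-}T}: f\in\mathcal F\}$ is *CoT-learned* over a domain $X\subseteq\Sigma^*$ by a rule $A$ with sample complexity $m(\varepsilon,\delta)$ if for every distribution $D$ over $X$, every $f_*\in\mathcal F$ and all $0<\varepsilon,\delta<1$, with probability at least $1-\delta$ over i.i.d. $x_1,\dots,x_m\sim D$, $m=m(\varepsilon,\delta)$, and with $S=(f_*^{\mathrm{CoT}\text{-}T}(x_1),\dots,f_*^{\mathrm{CoT}\text{-}T}(x_m))$, we have $\Pr_{x\sim D}\big(A(S)(x)\neq f_*^{\mathrm{e2e}\text{-}T}(x)\big)\le\varepsilon$. Algorithms are deterministic programs in a step-counting multi-stack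 machine model (polynomially equivalent to multi-tape Turing machines). They return functions through descriptions: a representation scheme $\rho$ assigns to every $d\in\mathbb N$ and every finite string $w$ a generator $\rho_d(w):\Sigma^*\to\Sigma$. Let $(\mathcal F_d)_{d\in\mathbb N}$ be a family of classes $\mathcal F_d\subseteq\Sigma^{\Sigma^*}$ and $\rho$ any representation scheme such that: (i) ($\mathrm{Cons}_{\mathcal F_d}$ is tractable) there is an algorithm that, given $d$ and labelled examples $(u_i,v_i)_{i}$ in $\Sigma^*\times\Sigma$ with which some member of $\mathcal F_d$ is consistent, returns some $w$ such that $\rho_d(w)\in\mathcal F_d$ and $\rho_d(w)(u_i)=v_i$ for all $i$, in time polynomial in the length of the examples and in $d$; (ii) $\mathrm{VCdim}(\mathcal F_d)$ is finite and bounded by a polynomial in $d$. Then $\mathrm{e2e}^T(\mathcal F_d)$ is CoT-learnable in time $\mathrm{poly}(n,d,T,\varepsilon^{-1},\log\delta^{-1})$. That is, there are one algorithm, which on $(S,d,T)$ returns a string $w=A_{d,T}(S)$, standing for the predictor $\rho_d(w)^{\mathrm{e2e}\text{-}T}$, a function $m_{d,T}(\varepsilon,\delta)$ and a polynomial $p$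 such that, for all $d\in\mathbb N$ and $T\ge1$: the rule CoT-learns $\mathrm{e2e}^T(\mathcal F_d)$ over every domain $X\subseteq\Sigma^*$ with sample complexity $m_{d,T}$; and for all $n$ and all $0<\varepsilon,\delta<1$ we have $m_{d,T}(\varepsilon,\delta)\le p(n,d,T,\varepsilon^{-1},\log\delta^{-1})$, and on every sample $S$ of size $m_{d,T}(\varepsilon,\delta)$ generated by a member of $\mathcal F_d$ from inputs of length at most $n$, $\rho_d(w)\in\mathcal F_d$ and the algorithm halts within $p(n,d,T,\varepsilon^{-1},\log\delta^{-1})$ steps. If moreover $\rho_d(w)(u)$ can be computed from $(w,d,u)$, for $\rho_d(w)\in\mathcal F_d$, in time polynomial in $|w|$, $d$ and $|u|$, then the learned predictor can be computed, by one algorithm that on inputs $x$ of length at most $n$ is given $(w,d,T,x)$, in time polynomial in $n,d,T,\varepsilon^{-1},\log\delta^{-1}$ as well. -/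

import Mathlib

open MeasureTheory

namespace CoTLearning

/-! ### Autoregressive generation over the binary alphabet -/

/-- Strings over the token alphabet `{0,1}`. -/
abbrev Str := List Bool

/-- A next-token generator `f : {0,1}* → {0,1}`. -/
abbrev Gen := Str → Bool

/-- Apply and append: `x ↦ append(x, f(x))`. -/
def applyAppend (f : Gen) (x : Str) : Str := x ++ [f x]

/-- The `T`-step Chain-of-Thought of `x`: apply-and-append iterated `T` times. -/
def cot (f : Gen) (T : ℕ) (x : Str) : Str := (applyAppend f)^[T] x

/-- The end-to-end map: the last token of the `T`-step Chain-of-Thought.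
It is only used for `T ≥ 1`, where the string is non-empty and the default is irrelevant. -/
def e2e (f : Gen) (T : ℕ) (x : Str) : Bool := (cot f T x).getLastD false

/-! ### VC dimension -/

/-- `H` shatters the finite set `s` of points: every labelling of `s` is realized by `H`. -/
def Shatters (H : Set Gen) (s : Finset Str) : Prop :=
  ∀ g : Str → Bool, ∃ h ∈ H, ∀ x ∈ s, h x = g x

/-- The VC dimension: the supremum of the sizes of the shattered sets. -/
noncomputable def vcDim (H : Set Gen) : ℕ∞ :=
  ⨆ (s : Finset Str) (_ : Shatters H s), (s.card : ℕ∞)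

/-! ### Realizable Chain-of-Thought learnability -/

/-- Strings form a countable set; every set of strings is measurable. -/
instance : MeasurableSpace Str := ⊤

/-- The Chain-of-Thought training set `(cot f T x₁, …, cot f T xₘ)`. -/
def cotSample (f : Gen) (T : ℕ) (xs : List Str) : List Str := xs.map (cot f T)

/-- The learning rule `A`, with sample complexity `m`, learns the `T`-step end-to-end class of `F`
over the domain `X` from Chain-of-Thought data: for every distribution `D` over `X`, every `f ∈ F`
and all `0 < ε, δ < 1`, with probability at least `1 - δ` over `m ε δ` independent draws from `D`,
the predictor `A S` has population error at most `ε`. -/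
def CoTLearns (F : Set Gen) (T : ℕ) (X : Set Str) (A : List Str → Str → Bool)
    (m : ℝ → ℝ → ℕ) : Prop :=
  ∀ D : Measure Str, IsProbabilityMeasure D → D Xᶜ = 0 →
    ∀ f ∈ F, ∀ ε δ : ℝ, 0 < ε → ε < 1 → 0 < δ → δ < 1 →
      ENNReal.ofReal (1 - δ) ≤
        Measure.pi (fun _ : Fin (m ε δ) => D)
          {xs | D {x | A (cotSample f T (List.ofFn xs)) x ≠ e2e f T x} ≤ ENNReal.ofReal ε}

/-! ### Machine model

Structured programs over finitely many stacks. Every elementary operation (push, pop, test of the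
top of a stack) takes one step. A tape is a pair of stacks, so multi-tape Turing machines and these
programs simulate each other with constant-factor overhead per step. -/

/-- The stack alphabet: the two bits and a separator. -/
inductive Symb : Type
  | bit (b : Bool)
  | sep

/-- A memory: the contents of the stacks, the top of a stack being the head of the list. -/
abbrev Store := ℕ → List Symb

/-- Programs. A test compares the top of stack `r` with `o`, where `o = none` tests for
emptiness. -/
inductive Prog : Type
  | skip
  | push (r : ℕ) (a : Symb)
  | pop (r : ℕ)
  | seq (p q : Prog)
  | cond (r : ℕ) (o : Option Symb) (p q : Prog)
  | loopUntil (r : ℕ) (o : Option Symb) (p : Prog)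

/-- `Run p s t s'`: started in memory `s`, the program `p` halts after exactly `t` steps in
memory `s'`. -/
inductive Run : Prog → Store → ℕ → Store → Prop
  | skip (s : Store) : Run Prog.skip s 1 s
  | push (r : ℕ) (a : Symb) (s : Store) :
      Run (Prog.push r a) s 1 (Function.update s r (a :: s r))
  | pop (r : ℕ) (s : Store) :
      Run (Prog.pop r) s 1 (Function.update s r (s r).tail)
  | seq {p q : Prog} {s s' s'' : Store} {t t' : ℕ} :
      Run p s t s' → Run q s' t' s'' → Run (Prog.seq p q) s (t + t') s''
  | condThen {r : ℕ} {o : Option Symb} {p q : Prog} {s s' : Store} {t : ℕ} :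
      (s r).head? = o → Run p s t s' → Run (Prog.cond r o p q) s (t + 1) s'
  | condElse {r : ℕ} {o : Option Symb} {p q : Prog} {s s' : Store} {t : ℕ} :
      (s r).head? ≠ o → Run q s t s' → Run (Prog.cond r o p q) s (t + 1) s'
  | loopDone {r : ℕ} {o : Option Symb} {p : Prog} {s : Store} :
      (s r).head? = o → Run (Prog.loopUntil r o p) s 1 s
  | loopStep {r : ℕ} {o : Option Symb} {p : Prog} {s s' s'' : Store} {t t' : ℕ} :
      (s r).head? ≠ o → Run p s t s' → Run (Prog.loopUntil r o p) s' t' s'' →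
        Run (Prog.loopUntil r o p) s (t + t' + 1) s''

/-- The initial memory: the inputs on stacks `0, 1, 2, …`, all other stacks empty. -/
def load (inputs : List (List Symb)) : Store := fun r => inputs.getD r []

/-- On the given inputs, `p` halts within `B` steps with `out` on stack `0`. -/
def Prog.Outputs (p : Prog) (inputs : List (List Symb)) (out : List Symb) (B : ℝ) : Prop :=
  ∃ (t : ℕ) (s : Store), Run p (load inputs) t s ∧ s 0 = out ∧ (t : ℝ) ≤ B

/-! ### Encodings -/

/-- A string of tokens as a string of stack symbols. -/
def encStr (x : Str) : List Symb := x.map Symb.bit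

/-- A number in unary (all running times below are polynomial in the value of the number). -/
def encNat (k : ℕ) : List Symb := List.replicate k (Symb.bit true)

/-- A list of strings, each followed by a separator. -/
def encStrs (S : List Str) : List Symb := S.flatMap fun z => encStr z ++ [Symb.sep]

/-- A list of labelled strings `(u, v)`, each written as `u`, a separator, the bit `v`. -/
def encLabelled (S : List (Str × Bool)) : List Symb :=
  S.flatMap fun e => encStr e.1 ++ [Symb.sep, Symb.bit e.2]

/-! ### Tractability

An algorithm returns a function by returning a description of it. A representation scheme `ρ` says
which generator `ρ d w` the string `w` describes at size parameter `d`. -/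

/-- The consistency problem for `F d` can be solved, with descriptions in the scheme `ρ`, in time
polynomial in the length of the input and `d`: given `d` and a labelled sample that some member of
`F d` fits, the program returns a description of a member of `F d` that fits the sample. -/
def ConsInPolyTime (F : ℕ → Set Gen) (ρ : ℕ → List Symb → Gen) : Prop :=
  ∃ (cons : Prog) (p : MvPolynomial (Fin 2) ℝ),
    ∀ (d : ℕ) (S : List (Str × Bool)), (∃ f ∈ F d, ∀ e ∈ S, f e.1 = e.2) →
      ∃ w : List Symb, ρ d w ∈ F d ∧ (∀ e ∈ S, ρ d w e.1 = e.2) ∧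
        cons.Outputs [encLabelled S, encNat d] w
          (MvPolynomial.eval ![((encLabelled S).length : ℝ), (d : ℝ)] p)

/-- Described members of `F d` can be evaluated in time polynomial in the length of the
description, `d` and the length of the argument. -/
def EvalInPolyTime (F : ℕ → Set Gen) (ρ : ℕ → List Symb → Gen) : Prop :=
  ∃ (ev : Prog) (p : MvPolynomial (Fin 3) ℝ),
    ∀ (d : ℕ) (w : List Symb), ρ d w ∈ F d → ∀ u : Str,
      ev.Outputs [w, encNat d, encStr u] [Symb.bit (ρ d w u)]
        (MvPolynomial.eval ![(w.length : ℝ), (d : ℝ), (u.length : ℝ)] p)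

/-- The VC dimension of `F d` is finite and bounded by a polynomial in `d`. -/
def VCPolyBounded (F : ℕ → Set Gen) : Prop :=
  ∃ p : Polynomial ℝ, ∀ d : ℕ, ∃ k : ℕ, vcDim (F d) = k ∧ (k : ℝ) ≤ p.eval (d : ℝ)

/-- The value of a polynomial at `(n, d, T, 1/ε, log (1/δ))`. -/
noncomputable def bound (p : MvPolynomial (Fin 5) ℝ) (n d T : ℕ) (ε δ : ℝ) : ℝ :=
  MvPolynomial.eval ![(n : ℝ), (d : ℝ), (T : ℝ), 1 / ε, Real.log (1 / δ)] p

/-- The `T`-step end-to-end class of `F d` is Chain-of-Thought learnable in time polynomial in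
`n, d, T, 1/ε, log (1/δ)`. One program `train` serves all parameters; it is given the sample, `d`
and `T`, and returns a description `A d T S` of a member of `F d`, the learned predictor being the
`T`-step end-to-end map of the described generator.
* The rule learns over every domain, with a sample complexity that does not depend on `n`.
* The sample complexity is polynomially bounded.
* On every sample of the prescribed size with inputs of length at most `n`, labelled by a member
  of `F d`, the rule is proper and `train` computes it in polynomial time.
* If described members of `F d` can be evaluated in polynomial time, then so can the learned
  predictor, on inputs of length at most `n`. -/
def CoTLearnableInPolyTime (F : ℕ → Set Gen) (ρ : ℕ → List Symb → Gen) : Prop :=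
  ∃ (train : Prog) (A : ℕ → ℕ → List Str → List Symb) (m : ℕ → ℕ → ℝ → ℝ → ℕ)
    (p : MvPolynomial (Fin 5) ℝ),
    (∀ d T : ℕ, 0 < T → ∀ X : Set Str,
      CoTLearns (F d) T X (fun S => e2e (ρ d (A d T S)) T) (m d T)) ∧
    (∀ (n d T : ℕ) (ε δ : ℝ), 0 < T → 0 < ε → ε < 1 → 0 < δ → δ < 1 →
      (m d T ε δ : ℝ) ≤ bound p n d T ε δ) ∧
    (∀ (n d T : ℕ) (ε δ : ℝ), 0 < T → 0 < ε → ε < 1 → 0 < δ → δ < 1 →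
      ∀ f ∈ F d, ∀ xs : List Str, xs.length = m d T ε δ → (∀ x ∈ xs, x.length ≤ n) →
        ρ d (A d T (cotSample f T xs)) ∈ F d ∧
        train.Outputs [encStrs (cotSample f T xs), encNat d, encNat T]
          (A d T (cotSample f T xs)) (bound p n d T ε δ)) ∧
    (EvalInPolyTime F ρ →
      ∃ (predict : Prog) (q : MvPolynomial (Fin 5) ℝ),
        ∀ (n d T : ℕ) (ε δ : ℝ), 0 < T → 0 < ε → ε < 1 → 0 < δ → δ < 1 →
          ∀ f ∈ F d, ∀ xs : List Str, xs.length = m d T ε δ → (∀ x ∈ xs, x.length ≤ n) →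
            ∀ x : Str, x.length ≤ n →
              predict.Outputs [A d T (cotSample f T xs), encNat d, encNat T, encStr x]
                [Symb.bit (e2e (ρ d (A d T (cotSample f T xs))) T x)] (bound q n d T ε δ))

end CoTLearning

open CoTLearning

open CoTLearning

namespace CoTLearning

/-! ### Counting the restrictions of a class of finite VC dimension -/

/-! A Chain-of-Thought of `f` on `x` contains the `T` next-token examples `(cot f j x, f (cot f j
x))`, `j < T`. The learner hands all of them to the consistency solver. If `h` agrees with `f` on
these prefixes of the chain of `f`, then the two chains coincide (`cot_congr`), so the end-to-end
error of `h` is at most the probability of the event that `h` disagrees with `f` somewhere along the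
chain of `f`. A consistent `h` is one whose event is missed by the sample.

It remains to show that no likely event of this kind is missed, which is symmetrization with a ghost
sample (`measure_exists_missed_le`). On `2m` points the events depend only on the restriction of `h`
to at most `2mT` prefixes, so by Sauer's lemma they have at most `(2mT+1)^k` traces, `k` being the
VC dimension of the base class itself. The end-to-end class needs no separate VC analysis.
`exists_hits_bound` turns this into a polynomial sample size.

The computational half is explicit programming. `extract` rewrites the sample as labelled prefixes
and leaves exactly the initial memory that the solver expects, so training is a sequential
composition. Prediction runs the given evaluator `T` times below a block of stacks that it cannot
touch (`Run.frame`), clearing its workspace after each call. A program writes at most one symbol per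
step, so the learned description has polynomial length (`Run.length_le`) and evaluating it stays
polynomial. -/

theorem sum_range_choose_le_pow (n k : ℕ) :
    ∑ i ∈ Finset.range (k + 1), n.choose i ≤ (n + 1) ^ k := by
  induction k with
  | zero => simp
  | succ k ih =>
    rw [Finset.sum_range_succ]
    have h : n.choose (k + 1) ≤ n * (n + 1) ^ k := by
      calc n.choose (k + 1) ≤ n ^ (k + 1) := Nat.choose_le_pow _ _
        _ = n * n ^ k := by ring
        _ ≤ n * (n + 1) ^ k := by gcongr; omega
    calc _ ≤ (n + 1) ^ k + n * (n + 1) ^ k := add_le_add ih h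
      _ = (n + 1) ^ (k + 1) := by ring

theorem Shatters.card_le {H : Set Gen} {k : ℕ} (hk : vcDim H = k) {s : Finset Str}
    (hs : Shatters H s) : s.card ≤ k := by
  have h : (s.card : ℕ∞) ≤ vcDim H := le_iSup₂_of_le s hs le_rfl
  rw [hk] at h
  exact_mod_cast h

open Classical in
/-- Sauer's lemma: the restrictions of `H` to `U` are represented by few members of `H`. -/
theorem exists_restriction_cover {H : Set Gen} {k : ℕ} (hk : vcDim H = k) (U : Finset Str) :
    ∃ R : Finset Gen, R.card ≤ (U.card + 1) ^ k ∧ ∀ h ∈ H, ∃ r ∈ R, ∀ u ∈ U, h u = r u := by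
  set 𝒜 : Finset (Finset Str) := U.powerset.filter fun A => ∃ h ∈ H, A = U.filter fun u => h u = true
    with h𝒜
  have hsub : 𝒜.shatterer ⊆ (Finset.range (k + 1)).biUnion fun i => U.powersetCard i := by
    intro s hs
    rw [Finset.mem_shatterer] at hs
    have hsU : s ⊆ U := by
      obtain ⟨t, ht, hst⟩ := hs.exists_superset
      rw [h𝒜, Finset.mem_filter, Finset.mem_powerset] at ht
      exact hst.trans ht.1
    have hH : Shatters H s := by
      intro g
      obtain ⟨t, ht, hst⟩ := hs (Finset.filter_subset (fun u => g u = true) s)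
      rw [h𝒜, Finset.mem_filter] at ht
      obtain ⟨-, h, hh, rfl⟩ := ht
      refine ⟨h, hh, fun x hx => ?_⟩
      have := congrArg (x ∈ ·) hst
      simp only [Finset.mem_inter, Finset.mem_filter, hx, hsU hx, true_and, eq_iff_iff] at this
      exact Bool.eq_iff_iff.2 this
    simp only [Finset.mem_biUnion, Finset.mem_range, Finset.mem_powersetCard]
    exact ⟨s.card, Nat.lt_succ_of_le (hH.card_le hk), hsU, rfl⟩
  have hcard : 𝒜.card ≤ (U.card + 1) ^ k :=
    -- Pajor's form of Sauer's lemma: a family has at most as many members as it shatters sets. Here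
    -- the shattered sets are subsets of `U` of size at most `k`.
    calc 𝒜.card ≤ 𝒜.shatterer.card := Finset.card_le_card_shatterer _
      _ ≤ _ := Finset.card_le_card hsub
      _ ≤ ∑ i ∈ Finset.range (k + 1), (U.powersetCard i).card := Finset.card_biUnion_le
      _ = ∑ i ∈ Finset.range (k + 1), U.card.choose i := by simp
      _ ≤ _ := sum_range_choose_le_pow _ _
  -- The representatives are the indicators of the traces. They need not lie in `H`; only their
  -- values on `U` matter.
  refine ⟨𝒜.image fun A u => decide (u ∈ A), Finset.card_image_le.trans hcard, fun h hh => ?_⟩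
  refine ⟨_, Finset.mem_image_of_mem _ (a := U.filter fun u => h u = true) ?_, fun u hu => ?_⟩
  · rw [h𝒜, Finset.mem_filter, Finset.mem_powerset]
    exact ⟨Finset.filter_subset _ _, h, hh, rfl⟩
  · simp [hu]

/-! ### Uniform convergence for consistent rules, by symmetrization with a ghost sample -/

section Symmetrization

variable {Ω : Type*}

open Classical in
/-- An event of probability at least `ε` is hit at least `a` times with probability at least `1/2`
by `m` independent draws. -/
theorem half_le_measure_hits [MeasurableSpace Ω] (D : Measure Ω) [IsProbabilityMeasure D] {E : Set Ω}
    (hE : MeasurableSet E) {ε : ℝ} (hε : ε ≤ D.real E) {m a : ℕ}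
    (ha : 2 ^ a * (1 - ε / 2) ^ m ≤ 1 / 2) :
    1 / 2 ≤ (Measure.pi fun _ : Fin m => D) {x | a ≤ (Finset.univ.filter fun i => x i ∈ E).card} := by
  set μ := Measure.pi fun _ : Fin m => D
  -- A Chernoff argument: the product of `g` over the draws is `2^(-hits)`, its mean is `(1 -
  -- D(E)/2)^m`, and Markov's inequality at level `2^(-a)` bounds the probability of too few hits.
  set g : Ω → ℝ := fun x => if x ∈ E then 1 / 2 else 1 with hg
  have hgE : g = fun x => 1 - E.indicator (fun _ => (1 / 2 : ℝ)) x := by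
    funext x
    by_cases hx : x ∈ E <;> simp [hg, hx]; norm_num
  have hgm : Measurable g := Measurable.ite hE measurable_const measurable_const
  have hint : ∫ x, g x ∂D = 1 - D.real E / 2 := by
    rw [hgE, integral_sub (integrable_const _) ((integrable_const _).indicator hE),
      integral_indicator_const _ hE]
    simp; ring
  have hprod : ∫ x, ∏ i, g (x i) ∂μ = (1 - D.real E / 2) ^ m := by
    have := integral_fintype_prod_eq_pow (ι := Fin m) (𝕜 := ℝ) g (μ := D)
    rw [this, hint, Fintype.card_fin]
  have hg0 : ∀ x, 0 ≤ g x := fun x => by simp only [hg]; split_ifs <;> norm_num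
  have hg1 : ∀ x, g x ≤ 1 := fun x => by simp only [hg]; split_ifs <;> norm_num
  have hpm : Measurable fun x : Fin m → Ω => ∏ i, g (x i) :=
    Finset.measurable_prod _ fun i _ => hgm.comp (measurable_pi_apply i)
  have hintg : Integrable (fun x : Fin m → Ω => ∏ i, g (x i)) μ := by
    refine Integrable.of_bound hpm.aestronglyMeasurable 1 (Filter.Eventually.of_forall fun x => ?_)
    rw [Real.norm_of_nonneg (Finset.prod_nonneg fun i _ => hg0 _)]
    exact Finset.prod_le_one (fun i _ => hg0 _) fun i _ => hg1 _
  have hmark := mul_meas_ge_le_integral_of_nonneg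
    (Filter.Eventually.of_forall fun x => Finset.prod_nonneg fun i _ => hg0 (x i)) hintg
    ((1 / 2 : ℝ) ^ a)
  rw [hprod] at hmark
  have hle : μ.real {x | (1 / 2 : ℝ) ^ a ≤ ∏ i, g (x i)} ≤ 1 / 2 := by
    have h1 : (1 - D.real E / 2) ^ m ≤ (1 - ε / 2) ^ m := by
      have := measureReal_le_one (μ := D) (s := E)
      gcongr
      linarith
    have h2 : (2 : ℝ) ^ a * ((1 / 2) ^ a * μ.real {x | (1 / 2 : ℝ) ^ a ≤ ∏ i, g (x i)}) ≤ 1 / 2 :=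
      le_trans (by gcongr; exact hmark.trans h1) ha
    rwa [← mul_assoc, ← mul_pow, mul_one_div_cancel two_ne_zero, one_pow, one_mul] at h2
  have hmeas : MeasurableSet {x : Fin m → Ω | (1 / 2 : ℝ) ^ a ≤ ∏ i, g (x i)} :=
    measurableSet_le measurable_const hpm
  have hcompl : 1 / 2 ≤ μ.real {x : Fin m → Ω | (1 / 2 : ℝ) ^ a ≤ ∏ i, g (x i)}ᶜ := by
    rw [probReal_compl_eq_one_sub hmeas]; linarith
  have hsub : {x : Fin m → Ω | (1 / 2 : ℝ) ^ a ≤ ∏ i, g (x i)}ᶜ ⊆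
      {x | a ≤ (Finset.univ.filter fun i => x i ∈ E).card} := by
    intro x hx
    by_contra hlt
    refine hx ?_
    have hp : ∏ i, g (x i) = (1 / 2) ^ (Finset.univ.filter fun i => x i ∈ E).card := by
      simp [hg, Finset.prod_ite]
    simp only [Set.mem_ofPred_eq, not_le] at hlt ⊢
    rw [hp]
    exact pow_le_pow_of_le_one (by norm_num) (by norm_num) hlt.le
  calc (1 / 2 : ENNReal) = ENNReal.ofReal (1 / 2) := by
        rw [ENNReal.ofReal_div_of_pos two_pos]; simp
    _ ≤ ENNReal.ofReal (μ.real {x : Fin m → Ω | (1 / 2 : ℝ) ^ a ≤ ∏ i, g (x i)}ᶜ) :=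
        ENNReal.ofReal_le_ofReal hcompl
    _ = μ _ := ofReal_measureReal
    _ ≤ _ := measure_mono hsub

open Classical in
/-- At most a fraction `2⁻ᵃ` of the swaps between a sample and its ghost avoids `E` on the sample
and hits it `a` times on the ghost. -/
theorem card_swaps_le (E : Set Ω) {m : ℕ} (a : ℕ) (z : Fin m → Bool → Ω) :
    (Finset.univ.filter fun σ : Fin m → Bool => (∀ i, z i (σ i) ∉ E) ∧
      a ≤ (Finset.univ.filter fun i => z i (!σ i) ∈ E).card).card * 2 ^ a ≤ 2 ^ m := by
  -- The product of these weights along `σ` dominates `2^a` on every bad swap. For each `i` the two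
  -- weights sum to at most `2`, whether none, one or both of the points of the pair lie in `E`, so
  -- the total over all swaps is at most `2^m`.
  set w : Fin m → Bool → ℕ := fun i b =>
    if z i b ∈ E then 0 else if z i (!b) ∈ E then 2 else 1 with hw
  rw [← smul_eq_mul]
  calc _ ≤ ∑ σ ∈ Finset.univ.filter fun σ : Fin m → Bool => (∀ i, z i (σ i) ∉ E) ∧
          a ≤ (Finset.univ.filter fun i => z i (!σ i) ∈ E).card, ∏ i, w i (σ i) := by
        refine Finset.card_nsmul_le_sum _ _ _ fun σ hσ => ?_
        obtain ⟨h0, ha⟩ := (Finset.mem_filter.1 hσ).2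
        have : ∏ i, w i (σ i) = 2 ^ (Finset.univ.filter fun i => z i (!σ i) ∈ E).card := by
          simp [hw, h0, Finset.prod_ite]
        rw [this]
        exact Nat.pow_le_pow_right two_pos ha
    _ ≤ ∑ σ : Fin m → Bool, ∏ i, w i (σ i) :=
        Finset.sum_le_sum_of_subset (Finset.filter_subset _ _)
    _ = ∏ i, ∑ b, w i b := by
        rw [Finset.prod_univ_sum, Fintype.piFinset_univ]
    _ ≤ ∏ _i : Fin m, 2 := by
        refine Finset.prod_le_prod' fun i _ => ?_
        simp only [hw, Fintype.sum_bool, Bool.not_true, Bool.not_false]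
        split_ifs <;> simp
    _ = 2 ^ m := by simp

open Classical in
/-- If the sets of `𝓔` have few traces on `2m` points, then with high probability every set of
`𝓔` that is missed by `m` independent draws has small probability. -/
theorem measure_exists_missed_le [MeasurableSpace Ω] [Countable Ω] [MeasurableSingletonClass Ω] (D : Measure Ω)
    [IsProbabilityMeasure D] (𝓔 : Set (Set Ω)) {m a G : ℕ} {ε : ℝ}
    (ha : 2 ^ a * (1 - ε / 2) ^ m ≤ 1 / 2)
    (hG : ∀ Z : Finset Ω, Z.card ≤ 2 * m → ∃ R : Finset (Set Ω), R.card ≤ G ∧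
      ∀ E ∈ 𝓔, ∃ E' ∈ R, ∀ z ∈ Z, z ∈ E ↔ z ∈ E') :
    (Measure.pi fun _ : Fin m => D).real {x | ∃ E ∈ 𝓔, ε < D.real E ∧ ∀ i, x i ∉ E} ≤
      2 * G / 2 ^ a := by
  set μ := Measure.pi fun _ : Fin m => D
  set B := {x : Fin m → Ω | ∃ E ∈ 𝓔, ε < D.real E ∧ ∀ i, x i ∉ E}
  set Q : Set ((Fin m → Ω) × (Fin m → Ω)) := {p | ∃ E ∈ 𝓔, (∀ i, p.1 i ∉ E) ∧
    a ≤ (Finset.univ.filter fun i => p.2 i ∈ E).card}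
  have hBm : MeasurableSet B := MeasurableSet.of_discrete
  have hQm : MeasurableSet Q := MeasurableSet.of_discrete
  -- Over each bad sample the ghost hits the missed set at least `a` times with probability at least
  -- one half.
  have h1 : (1 / 2) * μ B ≤ (μ.prod μ) Q := by
    rw [Measure.prod_apply hQm, ← setLIntegral_const]
    refine (setLIntegral_mono_ae' hBm ?_).trans (setLIntegral_le_lintegral B _)
    refine Filter.Eventually.of_forall fun x hx => ?_
    obtain ⟨E, hE, hεE, hx⟩ := hx
    refine (half_le_measure_hits D MeasurableSet.of_discrete hεE.le ha).trans (measure_mono ?_)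
    intro y hy
    exact ⟨E, hE, hx, hy⟩
  set ν := Measure.pi fun _ : Fin m => D.prod D
  set Q' : Set (Fin m → Ω × Ω) := {z | ∃ E ∈ 𝓔, (∀ i, (z i).1 ∉ E) ∧
    a ≤ (Finset.univ.filter fun i => (z i).2 ∈ E).card}
  have h2 : ν Q' = (μ.prod μ) Q :=
    (measurePreserving_arrowProdEquivProdArrow Ω Ω (Fin m) (fun _ => D) fun _ => D).measure_preimage
      hQm.nullMeasurableSet
  set φ : (Fin m → Bool) → (Fin m → Ω × Ω) → Fin m → Ω × Ω :=
    fun σ z i => if σ i then (z i).swap else z i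
  have hφ : ∀ σ, MeasurePreserving (φ σ) ν ν := fun σ =>
    measurePreserving_pi (fun _ => D.prod D) (fun _ => D.prod D)
      (f := fun i p => if σ i then p.swap else p) fun i => by
        by_cases h : σ i
        · simpa [h] using Measure.measurePreserving_swap
        · simp only [h]; exact MeasurePreserving.id (D.prod D)
  -- Swapping the two points of any pairs preserves the law, so the probability of `Q'` can be
  -- averaged over all `2^m` swaps. For a fixed double sample this leaves a counting problem.
  have h3 : (2 : ENNReal) ^ m * ν Q' = ∫⁻ z, ∑ σ, (φ σ ⁻¹' Q').indicator 1 z ∂ν := by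
    rw [lintegral_finsetSum _ fun σ _ => Measurable.of_discrete]
    simp_rw [lintegral_indicator_one (MeasurableSet.of_discrete (s := φ _ ⁻¹' Q')),
      (hφ _).measure_preimage (MeasurableSet.of_discrete (s := Q')).nullMeasurableSet]
    simp
  have h4 : ∀ z, (∑ σ, (φ σ ⁻¹' Q').indicator (1 : (Fin m → Ω × Ω) → ENNReal) z) * 2 ^ a ≤ G * 2 ^ m := by
    intro z
    set Z : Finset Ω := (Finset.univ.image fun i => (z i).1) ∪ Finset.univ.image fun i => (z i).2
    obtain ⟨R, hR, hRE⟩ := hG Z (by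
      refine (Finset.card_union_le _ _).trans ?_
      have h1 := Finset.card_image_le (s := (Finset.univ : Finset (Fin m))) (f := fun i => (z i).1)
      have h2 := Finset.card_image_le (s := (Finset.univ : Finset (Fin m))) (f := fun i => (z i).2)
      simp only [Finset.card_univ, Fintype.card_fin] at h1 h2
      omega)
    set y : Fin m → Bool → Ω := fun i b => if b then (z i).2 else (z i).1
    have hyZ : ∀ i b, y i b ∈ Z := fun i b => by
      cases b <;> simp [y, Z]
    have hφ1 : ∀ σ i, (φ σ z i).1 = y i (σ i) := fun σ i => by
      cases h : σ i <;> simp [φ, y, h]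
    have hφ2 : ∀ σ i, (φ σ z i).2 = y i (!σ i) := fun σ i => by
      cases h : σ i <;> simp [φ, y, h]
    set N : Set Ω → Finset (Fin m → Bool) := fun E => Finset.univ.filter fun σ =>
      (∀ i, y i (σ i) ∉ E) ∧ a ≤ (Finset.univ.filter fun i => y i (!σ i) ∈ E).card
    -- The witness `E` may depend on `σ`, but only its trace on the points of `z` enters. Hence the
    -- union bound runs over the representatives in `R`.
    have hsub : (Finset.univ.filter fun σ => φ σ z ∈ Q') ⊆ R.biUnion N := by
      intro σ hσ
      obtain ⟨E, hE, h0, ha⟩ := (Finset.mem_filter.1 hσ).2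
      obtain ⟨E', hE', hEE⟩ := hRE E hE
      refine Finset.mem_biUnion.2 ⟨E', hE', Finset.mem_filter.2 ⟨Finset.mem_univ _, ?_, ?_⟩⟩
      · intro i
        rw [← hEE _ (hyZ _ _), ← hφ1]
        exact h0 i
      · simp_rw [← hEE _ (hyZ _ _), ← hφ2]
        exact ha
    have hnat : (Finset.univ.filter fun σ => φ σ z ∈ Q').card * 2 ^ a ≤ G * 2 ^ m := by
      calc _ ≤ (∑ E ∈ R, (N E).card) * 2 ^ a := by
            gcongr
            exact (Finset.card_le_card hsub).trans Finset.card_biUnion_le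
        _ = ∑ E ∈ R, (N E).card * 2 ^ a := Finset.sum_mul _ _ _
        _ ≤ ∑ _E ∈ R, 2 ^ m := Finset.sum_le_sum fun E _ => card_swaps_le E a y
        _ = R.card * 2 ^ m := by simp
        _ ≤ _ := by gcongr
    have hsum : ∑ σ, (φ σ ⁻¹' Q').indicator (1 : (Fin m → Ω × Ω) → ENNReal) z =
        ((Finset.univ.filter fun σ => φ σ z ∈ Q').card : ENNReal) := by
      simp [Set.indicator_apply]
    rw [hsum]
    exact_mod_cast hnat
  have h5 : (2 : ENNReal) ^ m * ν Q' * 2 ^ a ≤ G * 2 ^ m := by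
    rw [h3, ← lintegral_mul_const _ Measurable.of_discrete]
    refine (lintegral_mono h4).trans ?_
    simp
  have h5' : (2 : ℝ) ^ m * ν.real Q' * 2 ^ a ≤ G * 2 ^ m := by
    have := ENNReal.toReal_mono (by finiteness) h5
    simpa [Measure.real] using this
  have h1' : (1 / 2) * μ.real B ≤ ν.real Q' := by
    rw [← h2] at h1
    have := ENNReal.toReal_mono (by finiteness) h1
    simpa [Measure.real] using this
  rw [le_div_iff₀ (by positivity)]
  have h6 : ν.real Q' * 2 ^ a ≤ G := by
    have h2m : (0 : ℝ) < 2 ^ m := by positivity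
    refine le_of_mul_le_mul_left ?_ h2m
    linarith
  have h7 : (1 / 2) * μ.real B * 2 ^ a ≤ ν.real Q' * 2 ^ a := by gcongr
  linarith

end Symmetrization

/-! ### Learning from Chain-of-Thought data by consistency -/

theorem cot_succ (f : Gen) (T : ℕ) (x : Str) : cot f (T + 1) x = cot f T x ++ [f (cot f T x)] := by
  simp only [cot, Function.iterate_succ_apply', applyAppend]

theorem length_cot (f : Gen) (T : ℕ) (x : Str) : (cot f T x).length = x.length + T := by
  induction T with
  | zero => rfl
  | succ T ih => rw [cot_succ, List.length_append, ih]; rfl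

/-- As long as no disagreement has occurred, `h` is queried at the same string as `f`. So agreement
is needed only on the prefixes visited by `f`, which are the ones seen in the data. -/
theorem cot_congr {f h : Gen} {T : ℕ} {x : Str}
    (H : ∀ j < T, h (cot f j x) = f (cot f j x)) : cot h T x = cot f T x := by
  induction T with
  | zero => rfl
  | succ T ih =>
    have ih := ih fun j hj => H j (by omega)
    rw [cot_succ, cot_succ, ih, H T (by omega)]

open Classical in
/-- With high probability, every member of `H` that reproduces the Chain-of-Thought of `f` on a
sample has small end-to-end error. -/
theorem measure_exists_consistent_le (D : Measure Str) [IsProbabilityMeasure D] {H : Set Gen} {k : ℕ}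
    (hk : vcDim H = k) (f : Gen) (T : ℕ) {m a : ℕ} {ε : ℝ}
    (ha : 2 ^ a * (1 - ε / 2) ^ m ≤ 1 / 2) :
    (Measure.pi fun _ : Fin m => D).real {x | ∃ h ∈ H, ε < D.real {y | e2e h T y ≠ e2e f T y} ∧
      ∀ i, ∀ j < T, h (cot f j (x i)) = f (cot f j (x i))} ≤
      2 * ((2 * m * T + 1) ^ k : ℕ) / 2 ^ a := by
  -- Disagreement is tested along the chain of the target `f`, not along that of `h`. The tested
  -- strings are thus the same for all `h`, and `T` per point suffice.
  set err : Gen → Set Str := fun h => {y | ∃ j < T, h (cot f j y) ≠ f (cot f j y)} with herr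
  have key := measure_exists_missed_le D (err '' H) (G := (2 * m * T + 1) ^ k) ha (by
    intro Z hZ
    set U : Finset Str := Z.biUnion fun z => (Finset.range T).image fun j => cot f j z
    have hU : U.card ≤ 2 * m * T := by
      calc U.card ≤ Z.card * T := Finset.card_biUnion_le_card_mul _ _ _ fun z _ =>
            Finset.card_image_le.trans (Finset.card_range T).le
        _ ≤ _ := by gcongr
    obtain ⟨R, hR, hRH⟩ := exists_restriction_cover hk U
    refine ⟨R.image err, Finset.card_image_le.trans (hR.trans (by gcongr)), ?_⟩
    rintro _ ⟨h, hh, rfl⟩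
    obtain ⟨r, hr, hhr⟩ := hRH h hh
    refine ⟨err r, Finset.mem_image_of_mem _ hr, fun z hz => ?_⟩
    have : ∀ j < T, h (cot f j z) = r (cot f j z) := fun j hj => hhr _ <|
      Finset.mem_biUnion.2 ⟨z, hz, Finset.mem_image_of_mem _ (Finset.mem_range.2 hj)⟩
    simp only [herr, Set.mem_ofPred_eq]
    exact exists_congr fun j => and_congr_right fun hj => by rw [this j hj])
  refine le_trans (measureReal_mono ?_) key
  rintro x ⟨h, hh, hε, hx⟩
  refine ⟨err h, ⟨h, hh, rfl⟩, hε.trans_le (measureReal_mono ?_), ?_⟩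
  · intro y hy
    by_contra hne
    refine hy ?_
    have : ∀ j < T, h (cot f j y) = f (cot f j y) := by simpa [herr] using hne
    simp only [e2e, cot_congr this]
  · rintro i ⟨j, hj, hne⟩
    exact hne (hx i j hj)

/-! ### The next-token examples contained in a Chain-of-Thought sample -/

/-- The examples obtained by removing the last `t` tokens of a reversed string one by one. -/
def peel : ℕ → Str → List (Str × Bool) → List (Str × Bool)
  | t + 1, v :: r, acc => peel t r ((r.reverse, v) :: acc)
  | _, _, acc => acc

/-- The next-token examples contained in a sample of Chains-of-Thought of length `T`. -/
def nextTokenSample (T : ℕ) (S : List Str) : List (Str × Bool) :=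
  S.foldl (fun acc z => peel T z.reverse acc) []

/-- Removing the last token of `cot f (j + 1) x` leaves `cot f j x`, and the removed token is the
answer of `f` there. Stopping after `T` removals avoids the tokens of the input, which `f` did not
generate. -/
theorem mem_peel_cot (f : Gen) (T : ℕ) (x : Str) (acc : List (Str × Bool)) (e : Str × Bool) :
    e ∈ peel T (cot f T x).reverse acc ↔
      (∃ j < T, e = (cot f j x, f (cot f j x))) ∨ e ∈ acc := by
  induction T generalizing acc with
  | zero => simp [peel]
  | succ T ih =>
    rw [cot_succ, List.reverse_append, List.reverse_singleton, List.singleton_append, peel, ih,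
      List.reverse_reverse, List.mem_cons, ← or_assoc]
    refine or_congr_left ⟨?_, ?_⟩
    · rintro (⟨j, hj, rfl⟩ | rfl)
      · exact ⟨j, by omega, rfl⟩
      · exact ⟨T, by omega, rfl⟩
    · rintro ⟨j, hj, rfl⟩
      rcases Nat.lt_succ_iff_lt_or_eq.1 hj with hj | rfl
      · exact Or.inl ⟨j, hj, rfl⟩
      · exact Or.inr rfl

theorem mem_nextTokenSample (f : Gen) (T : ℕ) (xs : List Str) (e : Str × Bool) :
    e ∈ nextTokenSample T (cotSample f T xs) ↔
      ∃ x ∈ xs, ∃ j < T, e = (cot f j x, f (cot f j x)) := by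
  have key : ∀ (xs : List Str) (acc : List (Str × Bool)),
      e ∈ (cotSample f T xs).foldl (fun acc z => peel T z.reverse acc) acc ↔
        (∃ x ∈ xs, ∃ j < T, e = (cot f j x, f (cot f j x))) ∨ e ∈ acc := by
    intro xs
    induction xs with
    | nil => simp [cotSample]
    | cons x xs ih =>
      intro acc
      rw [cotSample, List.map_cons, List.foldl_cons, ← cotSample, ih, mem_peel_cot, ← or_assoc]
      refine or_congr_left ?_
      rw [or_comm]
      simp
  rw [nextTokenSample, key]
  simp

theorem encLabelled_cons (u : Str) (v : Bool) (S : List (Str × Bool)) :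
    encLabelled ((u, v) :: S) = encStr u ++ Symb.sep :: Symb.bit v :: encLabelled S := by
  simp [encLabelled]

/-- Each example consists of a proper prefix, of length at most `L - 1`, followed by a separator and
a label. -/
theorem length_encLabelled_peel {t L : ℕ} {r : Str} (hr : r.length ≤ L)
    (acc : List (Str × Bool)) :
    (encLabelled (peel t r acc)).length ≤ (encLabelled acc).length + t * (L + 1) := by
  induction t generalizing r acc with
  | zero => simp [peel]
  | succ t ih =>
    cases r with
    | nil => simp [peel]
    | cons v r =>
      rw [List.length_cons] at hr
      refine (ih (by omega) _).trans ?_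
      rw [encLabelled_cons]
      simp only [List.length_append, List.length_cons, encStr, List.length_map,
        List.length_reverse]
      linarith

theorem length_encLabelled_foldl_peel {T L : ℕ} {S : List Str} (hS : ∀ z ∈ S, z.length ≤ L)
    (acc : List (Str × Bool)) :
    (encLabelled (S.foldl (fun acc z => peel T z.reverse acc) acc)).length ≤
      (encLabelled acc).length + S.length * (T * (L + 1)) := by
  induction S generalizing acc with
  | nil => simp
  | cons z S ih =>
    rw [List.foldl_cons]
    refine (ih (fun y hy => hS y (List.mem_cons_of_mem _ hy)) _).trans ?_
    have := length_encLabelled_peel (t := T) (r := z.reverse) (L := L)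
      (by simpa using hS z List.mem_cons_self) acc
    rw [List.length_cons]
    linarith

theorem length_encLabelled_nextTokenSample {T L : ℕ} {S : List Str}
    (hS : ∀ z ∈ S, z.length ≤ L) :
    (encLabelled (nextTokenSample T S)).length ≤ S.length * (T * (L + 1)) := by
  refine (length_encLabelled_foldl_peel (T := T) hS []).trans ?_
  simp [encLabelled]

/-! ### Running times of programs -/

/-- Started in `s`, the program `p` halts in `s'` within `B` steps. -/
def Exec (p : Prog) (s s' : Store) (B : ℕ) : Prop := ∃ t ≤ B, Run p s t s'

namespace Exec

variable {p q : Prog} {s s' s'' : Store} {B B' : ℕ} {r : ℕ} {o : Option Symb}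

theorem mono (h : Exec p s s' B) (hB : B ≤ B') : Exec p s s' B' :=
  let ⟨t, ht, hr⟩ := h
  ⟨t, ht.trans hB, hr⟩

theorem congr_right (h : Exec p s s' B) (hs : s' = s'') : Exec p s s'' B := hs ▸ h

theorem seq (h : Exec p s s' B) (h' : Exec q s' s'' B') : Exec (p.seq q) s s'' (B + B') :=
  let ⟨_, ht, hr⟩ := h
  let ⟨_, ht', hr'⟩ := h'
  ⟨_, add_le_add ht ht', Run.seq hr hr'⟩

theorem skip : Exec Prog.skip s s 1 := ⟨_, le_rfl, Run.skip s⟩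

theorem push (a : Symb) : Exec (Prog.push r a) s (Function.update s r (a :: s r)) 1 :=
  ⟨_, le_rfl, Run.push r a s⟩

theorem pop : Exec (Prog.pop r) s (Function.update s r (s r).tail) 1 :=
  ⟨_, le_rfl, Run.pop r s⟩

theorem condThen (ho : (s r).head? = o) (h : Exec p s s' B) :
    Exec (Prog.cond r o p q) s s' (B + 1) :=
  let ⟨_, ht, hr⟩ := h
  ⟨_, Nat.add_le_add_right ht 1, Run.condThen ho hr⟩

theorem condElse (ho : (s r).head? ≠ o) (h : Exec q s s' B) :
    Exec (Prog.cond r o p q) s s' (B + 1) :=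
  let ⟨_, ht, hr⟩ := h
  ⟨_, Nat.add_le_add_right ht 1, Run.condElse ho hr⟩

theorem loopDone (ho : (s r).head? = o) : Exec (Prog.loopUntil r o p) s s 1 :=
  ⟨_, le_rfl, Run.loopDone ho⟩

theorem loopStep (ho : (s r).head? ≠ o) (h : Exec p s s' B)
    (h' : Exec (Prog.loopUntil r o p) s' s'' B') :
    Exec (Prog.loopUntil r o p) s s'' (B + B' + 1) :=
  let ⟨_, ht, hr⟩ := h
  let ⟨_, ht', hr'⟩ := h'
  ⟨_, Nat.add_le_add_right (add_le_add ht ht') 1, Run.loopStep ho hr hr'⟩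

end Exec

/-- A step pushes at most one symbol. This bounds both the description returned by the solver and
the debris that the evaluator leaves on its stacks. -/
theorem Run.length_le {p : Prog} {s s' : Store} {t : ℕ} (h : Run p s t s') (r : ℕ) :
    (s' r).length ≤ (s r).length + t := by
  induction h with
  | skip s => omega
  | push r' a s =>
    by_cases hr : r = r'
    · subst hr; simp
    · simp [hr]
  | pop r' s =>
    by_cases hr : r = r'
    · subst hr; simp; omega
    · simp [hr]
  | seq _ _ ih ih' => omega
  | condThen _ _ ih => omega
  | condElse _ _ ih => omega
  | loopDone _ => omega
  | loopStep _ _ _ ih ih' => omega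

/-! ### Basic programs -/

/-- Push the top of stack `r` onto stack `r'`. -/
def pushTop (r r' : ℕ) : Prog :=
  .cond r (some (.bit true)) (.push r' (.bit true))
    (.cond r (some (.bit false)) (.push r' (.bit false)) (.push r' .sep))

/-- Move stack `r` to stack `r'`, reversing it, until the top of `r` is `o`. -/
def moveUntil (r : ℕ) (o : Option Symb) (r' : ℕ) : Prog :=
  .loopUntil r o (.seq (pushTop r r') (.pop r))

/-- Copy the reverse of stack `r` onto stack `r'`, with the help of the empty stack `c`. -/
def copyRev (r r' c : ℕ) : Prog :=
  .seq (.loopUntil r none (.seq (pushTop r r') (.seq (pushTop r c) (.pop r)))) (moveUntil c none r)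

/-- Empty the stack `r`. -/
def clear (r : ℕ) : Prog := .loopUntil r none (.pop r)

theorem exec_pushTop {s : Store} {r r' : ℕ} {a : Symb} (h : (s r).head? = some a) :
    Exec (pushTop r r') s (Function.update s r' (a :: s r')) 3 := by
  rcases a with (_ | _) | _
  · exact .condElse (by simp [h]) (.condThen h (.push _))
  · exact (Exec.condThen h (.push _)).mono (by omega)
  · exact .condElse (by simp [h]) (.condElse (by simp [h]) (.push _))

theorem exec_moveUntil {s : Store} {r r' : ℕ} {o : Option Symb} (hr : r ≠ r') {l l' : List Symb}
    (hs : s r = l ++ l') (hl : ∀ a ∈ l, some a ≠ o) (hl' : l'.head? = o) :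
    Exec (moveUntil r o r') s
      (Function.update (Function.update s r l') r' (l.reverse ++ s r')) (5 * l.length + 1) := by
  induction l generalizing s with
  | nil =>
    refine (Exec.loopDone (by rw [hs]; exact hl')).congr_right ?_
    funext i
    by_cases h1 : i = r' <;> by_cases h2 : i = r <;> simp_all
  | cons a l ih =>
    have ha : (s r).head? = some a := by rw [hs]; rfl
    refine (Exec.loopStep (by rw [ha]; exact hl a List.mem_cons_self)
      ((exec_pushTop ha).seq .pop) (ih ?_ fun b hb => hl b (List.mem_cons_of_mem _ hb))).congr_right
      ?_ |>.mono ?_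
    · simp [hr, hs]
    · funext i
      by_cases h1 : i = r' <;> by_cases h2 : i = r <;> simp_all
    · rw [List.length_cons]; omega

theorem exec_moveUntil_none {s : Store} {r r' : ℕ} (hr : r ≠ r') :
    Exec (moveUntil r none r') s
      (Function.update (Function.update s r []) r' ((s r).reverse ++ s r'))
      (5 * (s r).length + 1) :=
  exec_moveUntil hr (List.append_nil _).symm (by simp) rfl

theorem exec_copyRev_loop {s : Store} {r r' c : ℕ} (hr : r ≠ r') (hc : r ≠ c) (hc' : r' ≠ c)
    {l : List Symb} (hs : s r = l) :
    Exec (.loopUntil r none (.seq (pushTop r r') (.seq (pushTop r c) (.pop r)))) s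
      (Function.update (Function.update (Function.update s r []) r' (l.reverse ++ s r'))
        c (l.reverse ++ s c)) (8 * l.length + 1) := by
  induction l generalizing s with
  | nil =>
    refine (Exec.loopDone (by rw [hs]; rfl)).congr_right ?_
    funext i
    by_cases h1 : i = r' <;> by_cases h2 : i = r <;> by_cases h3 : i = c <;> simp_all
  | cons a l ih =>
    have ha : (s r).head? = some a := by rw [hs]; rfl
    refine (Exec.loopStep (by rw [ha]; simp)
      ((exec_pushTop ha).seq ((exec_pushTop (a := a) ?_).seq .pop)) (ih ?_)).congr_right
      ?_ |>.mono ?_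
    · simp [hr, hs]
    · simp [hr, hc, hs]
    · have hr' := hr.symm
      have hc'' := hc'.symm
      funext i
      by_cases h1 : i = r' <;> by_cases h2 : i = r <;> by_cases h3 : i = c <;> simp_all
    · rw [List.length_cons]; omega

theorem exec_copyRev {s : Store} {r r' c : ℕ} (hr : r ≠ r') (hc : r ≠ c) (hc' : r' ≠ c)
    (h0 : s c = []) :
    Exec (copyRev r r' c) s (Function.update s r' ((s r).reverse ++ s r'))
      (13 * (s r).length + 2) := by
  refine ((exec_copyRev_loop hr hc hc' rfl).seq (exec_moveUntil_none hc.symm)).congr_right ?_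
    |>.mono ?_
  · funext i
    by_cases h1 : i = r' <;> by_cases h2 : i = r <;> by_cases h3 : i = c <;> simp_all
  · simp [h0]; omega

theorem exec_clear {s : Store} {r : ℕ} :
    Exec (clear r) s (Function.update s r []) (2 * (s r).length + 1) := by
  generalize hl : s r = l
  induction l generalizing s with
  | nil => exact (Exec.loopDone (by rw [hl]; rfl)).congr_right (by rw [← hl]; simp)
  | cons a l ih =>
    refine (Exec.loopStep (by simp [hl]) .pop (ih (by simp [hl]))).congr_right (by simp) |>.mono ?_
    rw [List.length_cons]; omega

theorem update_load {L : List (List Symb)} {r : ℕ} (hr : r < L.length) (v : List Symb) :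
    Function.update (load L) r v = load (L.set r v) := by
  funext i
  by_cases h : i = r
  · subst h; simp [load, hr]
  · simp [load, h, List.getD_eq_getElem?_getD, List.getElem?_set_ne (Ne.symm h)]

/-- Unlisted stacks are empty, so auxiliary stacks can be made explicit or dropped at will when a
memory is written as a list. -/
theorem load_append_replicate (L : List (List Symb)) (k : ℕ) :
    load (L ++ List.replicate k []) = load L := by
  funext i
  simp only [load, List.getD_eq_getElem?_getD, List.getElem?_append]
  split_ifs with h
  · rfl
  · rw [List.getElem?_replicate, List.getElem?_eq_none (not_lt.1 h)]
    split_ifs <;> rfl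

/-! ### The training program -/

/-- Cut the last token off the reversed string on stack `3` and write the resulting example on
stack `4`; the counter on stack `2` is moved to stack `6`. -/
def peelStep : Prog :=
  .seq (.pop 2) (.seq (.push 6 (.bit true)) (.seq (pushTop 3 4) (.seq (.pop 3)
    (.seq (.push 4 .sep) (copyRev 3 4 5)))))

/-- Write the examples contained in the first string of the sample on stack `4`. -/
def peelFirst : Prog :=
  .seq (moveUntil 0 (some .sep) 3) (.seq (.pop 0) (.seq (.loopUntil 2 none peelStep)
    (.seq (moveUntil 6 none 2) (clear 3))))

/-- Replace a Chain-of-Thought sample by the next-token examples it contains. -/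
def extract : Prog :=
  .seq (.loopUntil 0 none peelFirst) (.seq (moveUntil 4 none 5) (.seq (moveUntil 5 none 0) (clear 2)))

/-- Stack `4` grows at its head, so the label is written before the separator and the prefix comes
last. Copying the reversed prefix reverses it once more, back into reading order. -/
theorem exec_peelStep (A D : List Symb) (t c : ℕ) (v : Bool) (r : Str) (acc : List (Str × Bool)) :
    Exec peelStep
      (load [A, D, encNat (t + 1), encStr (v :: r), encLabelled acc, [], encNat c])
      (load [A, D, encNat t, encStr r, encLabelled ((r.reverse, v) :: acc), [], encNat (c + 1)])
      (13 * r.length + 9) := by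
  refine (Exec.pop.seq ((Exec.push _).seq ((exec_pushTop (a := .bit v) ?_).seq (Exec.pop.seq
    ((Exec.push _).seq (exec_copyRev (by decide) (by decide) (by decide) ?_)))))).congr_right ?_
    |>.mono ?_
  all_goals simp only [update_load, List.length_cons, List.length_nil, Nat.reduceLT, Nat.reduceAdd,
    List.set_cons_succ, List.set_cons_zero]
  · rfl
  · rfl
  · simp [load, encLabelled_cons, encStr, encNat, List.replicate_succ, List.map_reverse]
  · simp [load, encStr]; omega

/-- The assumption `ht` keeps the program from cutting tokens off an empty stack. The used-up
counter is kept in `c`, to be restored for the next string. -/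
theorem exec_peel_loop (A D : List Symb) {t c L : ℕ} {r : Str} (ht : t ≤ r.length)
    (hL : r.length ≤ L) (acc : List (Str × Bool)) :
    Exec (.loopUntil 2 none peelStep)
      (load [A, D, encNat t, encStr r, encLabelled acc, [], encNat c])
      (load [A, D, [], encStr (r.drop t), encLabelled (peel t r acc), [], encNat (c + t)])
      (t * (13 * L + 10) + 1) := by
  induction t generalizing r c acc with
  | zero =>
    refine ((Exec.loopDone ?_).congr_right ?_).mono (B := 1) ?_
    · rfl
    · simp [peel, encNat]
    · simp
  | succ t ih =>
    cases r with
    | nil => simp at ht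
    | cons v r =>
      rw [List.length_cons] at ht hL
      refine (Exec.loopStep (by simp [load, encNat, List.replicate_succ])
        (exec_peelStep A D t c v r acc) (ih (by omega) (by omega) _)).congr_right ?_ |>.mono ?_
      · rw [peel, List.drop_succ_cons, add_assoc, add_comm 1 t]
      · linarith

theorem exec_peelFirst (A D : List Symb) {T L : ℕ} {z : Str} (hT : T ≤ z.length)
    (hL : z.length ≤ L) (acc : List (Str × Bool)) :
    Exec peelFirst
      (load [encStr z ++ .sep :: A, D, encNat T, [], encLabelled acc, [], []])
      (load [A, D, encNat T, [], encLabelled (peel T z.reverse acc), [], []])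
      (T * (13 * L + 15) + 7 * L + 5) := by
  have h1 : Exec (moveUntil 0 (some .sep) 3)
      (load [encStr z ++ .sep :: A, D, encNat T, [], encLabelled acc, [], []])
      (load [.sep :: A, D, encNat T, encStr z.reverse, encLabelled acc, [], []])
      (5 * L + 1) := by
    refine (exec_moveUntil (l := encStr z) (l' := .sep :: A) (by decide) rfl ?_ rfl).congr_right ?_
      |>.mono ?_
    · intro a ha
      obtain ⟨b, -, rfl⟩ := List.mem_map.1 ha
      simp
    · simp [update_load, encStr, load]
    · simp [encStr]; omega
  have h2 : Exec (.pop 0) (load [.sep :: A, D, encNat T, encStr z.reverse, encLabelled acc, [], []])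
      (load [A, D, encNat T, encStr z.reverse, encLabelled acc, [], encNat 0]) 1 :=
    Exec.pop.congr_right (by simp [update_load, load, encNat])
  have h3 := exec_peel_loop A D (t := T) (c := 0) (L := L) (r := z.reverse) (by simpa using hT)
    (by simpa using hL) acc
  have h4 : Exec (moveUntil 6 none 2)
      (load [A, D, [], encStr (z.reverse.drop T), encLabelled (peel T z.reverse acc), [],
        encNat (0 + T)])
      (load [A, D, encNat T, encStr (z.reverse.drop T), encLabelled (peel T z.reverse acc), [], []])
      (5 * T + 1) := by
    refine (exec_moveUntil_none (by decide)).congr_right ?_ |>.mono ?_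
    · simp [update_load, load, encNat]
    · simp [load, encNat]
  -- For a Chain-of-Thought, what is left on stack `3` is the original input, which carries no
  -- label.
  have h5 : Exec (clear 3)
      (load [A, D, encNat T, encStr (z.reverse.drop T), encLabelled (peel T z.reverse acc), [], []])
      (load [A, D, encNat T, [], encLabelled (peel T z.reverse acc), [], []])
      (2 * L + 1) := by
    refine exec_clear.congr_right ?_ |>.mono ?_
    · simp [update_load]
    · simp [load, encStr]; omega
  exact (h1.seq (h2.seq (h3.seq (h4.seq h5)))).mono (by linarith)

theorem exec_peelFirst_loop (D : List Symb) {T L : ℕ} {S : List Str}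
    (hT : ∀ z ∈ S, T ≤ z.length) (hL : ∀ z ∈ S, z.length ≤ L) (acc : List (Str × Bool)) :
    Exec (.loopUntil 0 none peelFirst)
      (load [encStrs S, D, encNat T, [], encLabelled acc, [], []])
      (load [[], D, encNat T, [],
        encLabelled (S.foldl (fun acc z => peel T z.reverse acc) acc), [], []])
      (S.length * (T * (13 * L + 15) + 7 * L + 6) + 1) := by
  induction S generalizing acc with
  | nil =>
    refine (Exec.loopDone ?_).mono (B := 1) ?_
    · rfl
    · simp
  | cons z S ih =>
    have henc : encStrs (z :: S) = encStr z ++ .sep :: encStrs S := by simp [encStrs]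
    refine (Exec.loopStep (B := T * (13 * L + 15) + 7 * L + 5) ?_ ?_
      (ih (fun y hy => hT y (List.mem_cons_of_mem _ hy))
        (fun y hy => hL y (List.mem_cons_of_mem _ hy)) (peel T z.reverse acc))).mono ?_
    · simp only [load, List.getD_cons_zero, henc]
      cases encStr z <;> simp
    · rw [henc]
      exact exec_peelFirst _ _ (hT z List.mem_cons_self) (hL z List.mem_cons_self) acc
    · rw [List.length_cons]; linarith

/-- All working stacks end up empty and the counter `T` is erased, so the final memory is literally
the initial memory of a consistency solver. -/
theorem exec_extract (D : List Symb) {T L : ℕ} {S : List Str}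
    (hT : ∀ z ∈ S, T ≤ z.length) (hL : ∀ z ∈ S, z.length ≤ L) :
    Exec extract (load [encStrs S, D, encNat T])
      (load [encLabelled (nextTokenSample T S), D])
      (S.length * (T * (23 * L + 25) + 7 * L + 6) + 2 * T + 4) := by
  set E := encLabelled (nextTokenSample T S) with hE
  have h0 : load [encStrs S, D, encNat T] =
      load [encStrs S, D, encNat T, [], encLabelled [], [], []] :=
    (load_append_replicate [encStrs S, D, encNat T] 4).symm
  have h0' : load [E, D] = load [E, D, [], [], [], [], []] :=
    (load_append_replicate [E, D] 5).symm
  have hlen : E.length ≤ S.length * (T * (L + 1)) := length_encLabelled_nextTokenSample hL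
  rw [h0, h0']
  have h1 := exec_peelFirst_loop D hT hL []
  rw [← nextTokenSample, ← hE] at h1
  -- A move reverses a stack, so the examples travel to stack `0` through stack `5`.
  have h2 : Exec (moveUntil 4 none 5) (load [[], D, encNat T, [], E, [], []])
      (load [[], D, encNat T, [], [], E.reverse, []]) (5 * E.length + 1) :=
    (exec_moveUntil_none (by decide)).congr_right (by simp [update_load, load])
  have h3 : Exec (moveUntil 5 none 0) (load [[], D, encNat T, [], [], E.reverse, []])
      (load [E, D, encNat T, [], [], [], []]) (5 * E.length + 1) := by
    refine (exec_moveUntil_none (by decide)).congr_right ?_ |>.mono ?_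
    · simp [update_load, load]
    · simp [load]
  have h4 : Exec (clear 2) (load [E, D, encNat T, [], [], [], []])
      (load [E, D, [], [], [], [], []]) (2 * T + 1) := by
    refine exec_clear.congr_right ?_ |>.mono ?_
    · simp [update_load]
    · simp [load, encNat]
  exact (h1.seq (h2.seq (h3.seq h4))).mono (by linarith)

/-! ### Running a program next to stacks that it does not use -/

/-- A bound for the stacks that a program uses. -/
def Prog.numStacks : Prog → ℕ
  | .skip => 0
  | .push r _ => r + 1
  | .pop r => r + 1
  | .seq p q => max p.numStacks q.numStacks
  | .cond r _ p q => max (r + 1) (max p.numStacks q.numStacks)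
  | .loopUntil r _ p => max (r + 1) p.numStacks

/-- The memory with the stacks of `a` below `N` and the stacks of `b` from `N` on. -/
def glue (N : ℕ) (a b : Store) : Store := fun r => if r < N then a r else b (r - N)

theorem glue_low {N r : ℕ} (hr : r < N) (a b : Store) : glue N a b r = a r := if_pos hr

theorem glue_high (N i : ℕ) (a b : Store) : glue N a b (N + i) = b i := by
  simp [glue]

theorem update_glue_low {N r : ℕ} (hr : r < N) (a b : Store) (v : List Symb) :
    Function.update (glue N a b) r v = glue N (Function.update a r v) b := by
  funext i
  by_cases h : i = r
  · subst h; simp [glue, hr]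
  · simp [glue, h]

theorem update_glue_high (N i : ℕ) (a b : Store) (v : List Symb) :
    Function.update (glue N a b) (N + i) v = glue N a (Function.update b i v) := by
  funext j
  by_cases h : j = N + i
  · subst h; simp [glue]
  · by_cases hj : j < N
    · simp [glue, h, hj]
    · have : j - N ≠ i := by omega
      simp [glue, h, hj, this]

/-- A program neither reads nor writes stacks beyond those it names, so it behaves identically, step
for step, whatever lies from `N` on. This protects the state of the generation while an arbitrary
evaluator runs. -/
theorem Run.frame {p : Prog} {s s' : Store} {t : ℕ} (h : Run p s t s') {N : ℕ}
    (hN : p.numStacks ≤ N) (b : Store) : Run p (glue N s b) t (glue N s' b) := by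
  induction h with
  | skip s => exact .skip _
  | push r a s =>
    have hr : r < N := hN
    rw [← update_glue_low hr, ← glue_low hr s b]
    exact .push _ _ _
  | pop r s =>
    have hr : r < N := hN
    rw [← update_glue_low hr, ← glue_low hr s b]
    exact .pop _ _
  | seq _ _ ih ih' =>
    simp only [Prog.numStacks, max_le_iff] at hN
    exact .seq (ih hN.1) (ih' hN.2)
  | condThen ho _ ih =>
    simp only [Prog.numStacks, max_le_iff] at hN
    exact .condThen (by rw [glue_low hN.1]; exact ho) (ih hN.2.1)
  | condElse ho _ ih =>
    simp only [Prog.numStacks, max_le_iff] at hN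
    exact .condElse (by rw [glue_low hN.1]; exact ho) (ih hN.2.2)
  | loopDone ho =>
    simp only [Prog.numStacks, max_le_iff] at hN
    exact .loopDone (by rw [glue_low hN.1]; exact ho)
  | loopStep ho _ _ ih ih' =>
    have hN' := hN
    simp only [Prog.numStacks, max_le_iff] at hN'
    exact .loopStep (by rw [glue_low hN'.1]; exact ho) (ih hN'.2) (ih' hN)

/-- Empty all stacks below `N`. -/
def clearBelow : ℕ → Prog
  | 0 => .skip
  | N + 1 => .seq (clearBelow N) (clear N)

theorem exec_clearBelow {N M : ℕ} {s : Store} (hs : ∀ r < N, (s r).length ≤ M) :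
    Exec (clearBelow N) s (fun r => if r < N then [] else s r) (N * (2 * M + 1) + 1) := by
  induction N with
  | zero => exact (Exec.skip.congr_right (by simp)).mono (by simp)
  | succ N ih =>
    refine (((ih fun r hr => hs r (by omega)).seq exec_clear).congr_right ?_).mono ?_
    · funext i
      by_cases h : i = N
      · subst h; simp
      · have : i < N + 1 ↔ i < N := by omega
        simp [h, this]
    · simp only [lt_irrefl, if_false]
      linarith [hs N (by omega)]

/-! ### The prediction program -/

/-- One step of generation. The stacks `N, …, N + 4` hold the reversed description, the size
parameter, a counter, the reversed current string, and auxiliary data. -/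
def generateStep (ev : Prog) (N : ℕ) : Prog :=
  .seq (.pop (N + 2)) (.seq (copyRev (N + 0) 0 (N + 4)) (.seq (copyRev (N + 1) 1 (N + 4))
    (.seq (copyRev (N + 3) 2 (N + 4)) (.seq ev (.seq (pushTop 0 (N + 3)) (clearBelow N))))))

/-- Generate as many tokens as the counter says and output the last one. -/
def generate (ev : Prog) (N : ℕ) : Prog :=
  .seq (moveUntil 0 none (N + 0)) (.seq (moveUntil 1 none (N + 1)) (.seq (moveUntil 2 none (N + 2))
    (.seq (moveUntil 3 none (N + 3)) (.seq (.loopUntil (N + 2) none (generateStep ev N))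
      (pushTop (N + 3) 0)))))

theorem load_length_le {L : List (List Symb)} {M : ℕ} (hL : ∀ l ∈ L, l.length ≤ M) (r : ℕ) :
    (load L r).length ≤ M := by
  rw [load, List.getD_eq_getElem?_getD]
  rcases h : L[r]? with _ | l
  · simp
  · exact hL l (List.mem_of_getElem? h)

/-- The protected data are stored reversed because copying reverses; for the current string this
also makes appending a token a single push. Of the memory left by `ev` only stack `0` is known, so
everything below `N` is cleared before the next call, at a cost controlled by `Run.length_le`. -/
theorem exec_generateStep {ev : Prog} {N : ℕ} (hN : 4 ≤ N) (hev : ev.numStacks ≤ N)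
    {w : List Symb} {d : ℕ} {u : Str} {b : Bool} {E M : ℕ} (hw : w.length ≤ M) (hd : d ≤ M)
    (hu : u.length ≤ M)
    (hrun : ∃ s t, t ≤ E ∧ Run ev (load [w, encNat d, encStr u]) t s ∧ s 0 = [Symb.bit b]) (t : ℕ) :
    Exec (generateStep ev N)
      (glue N (load []) (load [w.reverse, encNat d, encNat (t + 1), encStr u.reverse, []]))
      (glue N (load []) (load [w.reverse, encNat d, encNat t, encStr (u ++ [b]).reverse, []]))
      (39 * M + 11 + E + N * (2 * (M + E + 1) + 1)) := by
  obtain ⟨s, k, hk, hrun, hs⟩ := hrun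
  have h0 : load [] = load [[], [], []] := (load_append_replicate [] 3).symm
  have hrev : (encNat d).reverse = encNat d := by simp [encNat]
  have h1 : Exec (.pop (N + 2))
      (glue N (load []) (load [w.reverse, encNat d, encNat (t + 1), encStr u.reverse, []]))
      (glue N (load [[], [], []]) (load [w.reverse, encNat d, encNat t, encStr u.reverse, []])) 1 :=
    Exec.pop.congr_right (by
      rw [update_glue_high, glue_high, update_load (by simp), h0]
      simp [load, encNat, List.replicate_succ])
  have hcopy : ∀ (i j : ℕ) (L : List (List Symb)) (l : List Symb), i < 4 → j < 3 → L.length = 3 →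
      load [w.reverse, encNat d, encNat t, encStr u.reverse, []] i = l → load L j = [] →
      l.length ≤ M →
      Exec (copyRev (N + i) j (N + 4))
        (glue N (load L) (load [w.reverse, encNat d, encNat t, encStr u.reverse, []]))
        (glue N (load (L.set j l.reverse))
          (load [w.reverse, encNat d, encNat t, encStr u.reverse, []])) (13 * M + 2) := by
    intro i j L l hi hj hL hl hlj hlM
    refine ((exec_copyRev (by omega) (by omega) (by omega) ?_).congr_right ?_).mono ?_
    · rw [glue_high]; rfl
    · rw [glue_high, glue_low (by omega), update_glue_low (by omega), update_load (by omega), hl,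
        hlj, List.append_nil]
    · rw [glue_high, hl]; omega
  have h2 := hcopy 0 0 [[], [], []] w.reverse (by omega) (by omega) rfl rfl rfl (by simpa using hw)
  have h3 := hcopy 1 1 [w.reverse.reverse, [], []] (encNat d) (by omega) (by omega) rfl rfl rfl
    (by simpa [encNat] using hd)
  have h4 := hcopy 3 2 [w.reverse.reverse, (encNat d).reverse, []] (encStr u.reverse) (by omega)
    (by omega) rfl rfl rfl (by simpa [encStr] using hu)
  have h5 : Exec ev
      (glue N (load [w.reverse.reverse, (encNat d).reverse, (encStr u.reverse).reverse])
        (load [w.reverse, encNat d, encNat t, encStr u.reverse, []]))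
      (glue N s (load [w.reverse, encNat d, encNat t, encStr u.reverse, []])) E := by
    refine ⟨k, hk, Run.frame ?_ hev _⟩
    rw [List.reverse_reverse, hrev, encStr, ← List.map_reverse, List.reverse_reverse]
    exact hrun
  have h6 : Exec (pushTop 0 (N + 3))
      (glue N s (load [w.reverse, encNat d, encNat t, encStr u.reverse, []]))
      (glue N s (load [w.reverse, encNat d, encNat t, encStr (u ++ [b]).reverse, []])) 3 := by
    refine (exec_pushTop (a := .bit b) ?_).congr_right ?_
    · rw [glue_low (by omega), hs]; rfl
    · rw [glue_high, update_glue_high, update_load (by simp)]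
      simp [load, encStr]
  have hlen : ∀ r < N, ∀ c, (glue N s c r).length ≤ M + E + 1 := by
    intro r hr c
    rw [glue_low hr]
    refine (hrun.length_le r).trans ?_
    have := load_length_le (L := [w, encNat d, encStr u]) (M := M)
      (by simp [encNat, encStr, hw, hd, hu]) r
    omega
  have h7 : Exec (clearBelow N)
      (glue N s (load [w.reverse, encNat d, encNat t, encStr (u ++ [b]).reverse, []]))
      (glue N (load []) (load [w.reverse, encNat d, encNat t, encStr (u ++ [b]).reverse, []]))
      (N * (2 * (M + E + 1) + 1) + 1) := by
    refine (exec_clearBelow fun r hr => hlen r hr _).congr_right ?_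
    funext r
    by_cases hr : r < N <;> simp [glue, hr, load]
  exact (h1.seq (h2.seq (h3.seq (h4.seq (h5.seq (h6.seq h7)))))).mono (by omega)

theorem exec_generate_loop {ev : Prog} {N : ℕ} (hN : 4 ≤ N) (hev : ev.numStacks ≤ N)
    {w : List Symb} {d : ℕ} {h : Gen} {E M : ℕ} (hw : w.length ≤ M) (hd : d ≤ M)
    (hrun : ∀ u : Str, u.length ≤ M →
      ∃ s t, t ≤ E ∧ Run ev (load [w, encNat d, encStr u]) t s ∧ s 0 = [Symb.bit (h u)])
    {t : ℕ} {u : Str} (hu : u.length + t ≤ M) :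
    Exec (.loopUntil (N + 2) none (generateStep ev N))
      (glue N (load []) (load [w.reverse, encNat d, encNat t, encStr u.reverse, []]))
      (glue N (load []) (load [w.reverse, encNat d, [], encStr (cot h t u).reverse, []]))
      (t * (39 * M + 12 + E + N * (2 * (M + E + 1) + 1)) + 1) := by
  induction t generalizing u with
  | zero =>
    refine (Exec.loopDone ?_).mono (B := 1) ?_
    · rw [glue_high]; rfl
    · simp
  | succ t ih =>
    -- Iteration unfolds at the innermost application, so `cot h (t + 1) u` is by definition `cot h
    -- t (u ++ [h u])`.
    refine (Exec.loopStep ?_ (exec_generateStep hN hev hw hd (by omega) (hrun u (by omega)) t)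
      (ih ?_)).mono ?_
    · rw [glue_high]; simp [load, encNat, List.replicate_succ]
    · rw [List.length_append, List.length_singleton]; omega
    · linarith

theorem exec_generate {ev : Prog} {N : ℕ} (hN : 4 ≤ N) (hev : ev.numStacks ≤ N)
    {w : List Symb} {d : ℕ} {h : Gen} {E M : ℕ} (hw : w.length ≤ M) (hd : d ≤ M)
    (hrun : ∀ u : Str, u.length ≤ M →
      ∃ s t, t ≤ E ∧ Run ev (load [w, encNat d, encStr u]) t s ∧ s 0 = [Symb.bit (h u)])
    {T : ℕ} (hT : 0 < T) {x : Str} (hx : x.length + T ≤ M) :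
    ∃ s, Exec (generate ev N) (load [w, encNat d, encNat T, encStr x]) s
      (T * (39 * M + 12 + E + N * (2 * (M + E + 1) + 1)) + 20 * M + 8) ∧
      s 0 = [Symb.bit (e2e h T x)] := by
  have hrev : ∀ k, (encNat k).reverse = encNat k := by simp [encNat]
  have h0 : load [w, encNat d, encNat T, encStr x] =
      glue N (load [w, encNat d, encNat T, encStr x]) (load [[], [], [], [], []]) := by
    funext r
    by_cases hr : r < N
    · simp [glue, hr]
    · have h1 := congrFun (load_append_replicate [] 5) (r - N)
      have h2 : load [w, encNat d, encNat T, encStr x] r = [] := by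
        simp only [load]
        exact List.getD_eq_default _ _ (by simp; omega)
      rw [h2, glue, if_neg hr]
      exact h1.symm
  have hmove : ∀ (i : ℕ) (L L' : List (List Symb)), i < 4 → L.length = 4 → L'.length = 5 →
      load L' i = [] → (load L i).length ≤ M →
      Exec (moveUntil i none (N + i)) (glue N (load L) (load L'))
        (glue N (load (L.set i [])) (load (L'.set i (load L i).reverse))) (5 * M + 1) := by
    intro i L L' hi hL hL' hi' hM
    refine ((exec_moveUntil_none (by omega)).congr_right ?_).mono ?_
    · rw [glue_high, glue_low (by omega), update_glue_low (by omega), update_glue_high,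
        update_load (by omega), update_load (by omega), hi', List.append_nil]
    · rw [glue_low (by omega)]; omega
  have h1 := hmove 0 [w, encNat d, encNat T, encStr x] [[], [], [], [], []] (by omega) rfl rfl rfl hw
  have h2 := hmove 1 [[], encNat d, encNat T, encStr x] [w.reverse, [], [], [], []]
    (by omega) rfl rfl rfl (by simpa [load, encNat] using hd)
  have h3 := hmove 2 [[], [], encNat T, encStr x] [w.reverse, (encNat d).reverse, [], [], []]
    (by omega) rfl rfl rfl (by simp [load, encNat]; omega)
  have h4 := hmove 3 [[], [], [], encStr x]
    [w.reverse, (encNat d).reverse, (encNat T).reverse, [], []]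
    (by omega) rfl rfl rfl (by simp [load, encStr]; omega)
  have h4' : glue N (load [[], [], [], []])
      (load [w.reverse, (encNat d).reverse, (encNat T).reverse, (encStr x).reverse, []]) =
      glue N (load []) (load [w.reverse, encNat d, encNat T, encStr x.reverse, []]) := by
    rw [hrev, hrev, encStr, encStr, List.map_reverse]
    exact congrArg (glue N · _) (load_append_replicate [] 4)
  have h5 := exec_generate_loop hN hev hw hd hrun hx
  obtain ⟨T, rfl⟩ := Nat.exists_eq_succ_of_ne_zero hT.ne'
  have he : e2e h (T + 1) x = h (cot h T x) := by
    rw [e2e, cot_succ]; simp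
  have h6 := exec_pushTop (r' := 0) (r := N + 3) (a := .bit (h (cot h T x)))
    (s := glue N (load []) (load [w.reverse, encNat d, [], encStr (cot h (T + 1) x).reverse, []]))
    (by rw [glue_high, cot_succ]; simp [load, encStr])
  have h7 := h1.seq (h2.seq (h3.seq ((h4.congr_right h4').seq (h5.seq h6))))
  rw [← h0] at h7
  refine ⟨_, h7.mono (by omega), ?_⟩
  rw [he, Function.update_self, glue_low (by omega)]
  rfl

/-! ### Polynomial bounds -/

/-- A given time bound may have negative coefficients and fail to be monotone. The bound obtained
here is monotone, so the actual sizes can be replaced by upper estimates. Absolute values let the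
induction pass through multiplication. -/
theorem exists_abs_eval_le {n : ℕ} (p : MvPolynomial (Fin n) ℝ) :
    ∃ C k : ℕ, ∀ x : Fin n → ℕ,
      |MvPolynomial.eval (fun i => (x i : ℝ)) p| ≤ (C * (1 + ∑ i, x i) ^ k : ℕ) := by
  induction p using MvPolynomial.induction_on with
  | C a =>
    refine ⟨⌈|a|⌉₊, 0, fun x => ?_⟩
    simpa using Nat.le_ceil |a|
  | add p q hp hq =>
    obtain ⟨C, k, h⟩ := hp
    obtain ⟨C', k', h'⟩ := hq
    refine ⟨C + C', k + k', fun x => ?_⟩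
    rw [map_add]
    refine (abs_add_le _ _).trans ((add_le_add (h x) (h' x)).trans ?_)
    rw [← Nat.cast_add, Nat.cast_le, add_mul]
    gcongr <;> omega
  | mul_X p i hp =>
    obtain ⟨C, k, h⟩ := hp
    refine ⟨C, k + 1, fun x => ?_⟩
    rw [map_mul, MvPolynomial.eval_X, abs_mul, Nat.abs_cast]
    have hi : x i ≤ 1 + ∑ j, x j :=
      (Finset.single_le_sum (fun j _ => Nat.zero_le (x j)) (Finset.mem_univ i)).trans (by omega)
    calc _ ≤ ((C * (1 + ∑ i, x i) ^ k : ℕ) : ℝ) * ((1 + ∑ j, x j : ℕ) : ℝ) := by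
          gcongr
          exact h x
      _ = _ := by rw [← Nat.cast_mul, pow_succ, mul_assoc]

theorem exists_eval_two_le (p : MvPolynomial (Fin 2) ℝ) :
    ∃ C k : ℕ, ∀ a b : ℕ,
      MvPolynomial.eval ![(a : ℝ), (b : ℝ)] p ≤ (C * (1 + (a + b)) ^ k : ℕ) := by
  obtain ⟨C, k, h⟩ := exists_abs_eval_le p
  refine ⟨C, k, fun a b => ?_⟩
  have := (le_abs_self _).trans (h ![a, b])
  rw [Fin.sum_univ_two] at this
  rwa [show ![(a : ℝ), (b : ℝ)] = fun i => ((![a, b] i : ℕ) : ℝ) by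
    funext i; fin_cases i <;> rfl]

theorem exists_eval_three_le (p : MvPolynomial (Fin 3) ℝ) :
    ∃ C k : ℕ, ∀ a b c : ℕ,
      MvPolynomial.eval ![(a : ℝ), (b : ℝ), (c : ℝ)] p ≤ (C * (1 + (a + b + c)) ^ k : ℕ) := by
  obtain ⟨C, k, h⟩ := exists_abs_eval_le p
  refine ⟨C, k, fun a b c => ?_⟩
  have := (le_abs_self _).trans (h ![a, b, c])
  rw [Fin.sum_univ_three] at this
  rwa [show ![(a : ℝ), (b : ℝ), (c : ℝ)] = fun i => ((![a, b, c] i : ℕ) : ℝ) by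
    funext i; fin_cases i <;> rfl]

/-- A nonnegative quantity that is polynomially bounded in `n, d, T, 1/ε, log (1/δ)`. -/
def PolyBdd (g : ℕ → ℕ → ℕ → ℝ → ℝ → ℝ) : Prop :=
  ∃ p : MvPolynomial (Fin 5) ℝ, ∀ (n d T : ℕ) (ε δ : ℝ), 0 < T → 0 < ε → ε < 1 → 0 < δ → δ < 1 →
    0 ≤ g n d T ε δ ∧ g n d T ε δ ≤ bound p n d T ε δ

namespace PolyBdd

variable {g h : ℕ → ℕ → ℕ → ℝ → ℝ → ℝ}

theorem mono (hg : PolyBdd g)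
    (hh : ∀ (n d T : ℕ) (ε δ : ℝ), 0 < T → 0 < ε → ε < 1 → 0 < δ → δ < 1 →
      0 ≤ h n d T ε δ ∧ h n d T ε δ ≤ g n d T ε δ) : PolyBdd h := by
  obtain ⟨p, hp⟩ := hg
  refine ⟨p, fun n d T ε δ h1 h2 h3 h4 h5 => ?_⟩
  exact ⟨(hh n d T ε δ h1 h2 h3 h4 h5).1,
    (hh n d T ε δ h1 h2 h3 h4 h5).2.trans (hp n d T ε δ h1 h2 h3 h4 h5).2⟩

theorem add (hg : PolyBdd g) (hh : PolyBdd h) :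
    PolyBdd fun n d T ε δ => g n d T ε δ + h n d T ε δ := by
  obtain ⟨p, hp⟩ := hg
  obtain ⟨q, hq⟩ := hh
  refine ⟨p + q, fun n d T ε δ h1 h2 h3 h4 h5 => ?_⟩
  obtain ⟨a, b⟩ := hp n d T ε δ h1 h2 h3 h4 h5
  obtain ⟨a', b'⟩ := hq n d T ε δ h1 h2 h3 h4 h5
  refine ⟨add_nonneg a a', ?_⟩
  rw [bound, map_add]
  exact add_le_add b b'

theorem mul (hg : PolyBdd g) (hh : PolyBdd h) :
    PolyBdd fun n d T ε δ => g n d T ε δ * h n d T ε δ := by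
  obtain ⟨p, hp⟩ := hg
  obtain ⟨q, hq⟩ := hh
  refine ⟨p * q, fun n d T ε δ h1 h2 h3 h4 h5 => ?_⟩
  obtain ⟨a, b⟩ := hp n d T ε δ h1 h2 h3 h4 h5
  obtain ⟨a', b'⟩ := hq n d T ε δ h1 h2 h3 h4 h5
  refine ⟨mul_nonneg a a', ?_⟩
  rw [bound, map_mul]
  exact mul_le_mul b b' a' (a.trans b)

theorem const {c : ℝ} (hc : 0 ≤ c) : PolyBdd fun _ _ _ _ _ => c :=
  ⟨MvPolynomial.C c, fun n d T ε δ _ _ _ _ _ => ⟨hc, by simp [bound]⟩⟩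

theorem pow (hg : PolyBdd g) (k : ℕ) : PolyBdd fun n d T ε δ => g n d T ε δ ^ k := by
  induction k with
  | zero => simpa using const zero_le_one
  | succ k ih => simpa only [pow_succ] using ih.mul hg

theorem length : PolyBdd fun n _ _ _ _ => n :=
  ⟨MvPolynomial.X 0, fun n d T ε δ _ _ _ _ _ => ⟨Nat.cast_nonneg _, by simp [bound]⟩⟩

theorem parameter : PolyBdd fun _ d _ _ _ => d :=
  ⟨MvPolynomial.X 1, fun n d T ε δ _ _ _ _ _ => ⟨Nat.cast_nonneg _, by simp [bound]⟩⟩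

theorem steps : PolyBdd fun _ _ T _ _ => T :=
  ⟨MvPolynomial.X 2, fun n d T ε δ _ _ _ _ _ => ⟨Nat.cast_nonneg _, by simp [bound]⟩⟩

theorem accuracy : PolyBdd fun _ _ _ ε _ => 1 / ε :=
  ⟨MvPolynomial.X 3, fun n d T ε δ _ h _ _ _ => ⟨by positivity, by simp [bound]⟩⟩

theorem confidence : PolyBdd fun _ _ _ _ δ => Real.log (1 / δ) :=
  ⟨MvPolynomial.X 4, fun n d T ε δ _ _ _ h h' =>
    ⟨Real.log_nonneg (one_le_one_div h h'.le), by simp [bound]⟩⟩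

theorem of_eval {k : ℕ → ℕ} {P : Polynomial ℝ} (hk : ∀ d : ℕ, (k d : ℝ) ≤ P.eval (d : ℝ)) :
    PolyBdd fun _ d _ _ _ => k d := by
  refine ⟨Polynomial.aeval (MvPolynomial.X 1) P, fun n d T ε δ _ _ _ _ _ =>
    ⟨Nat.cast_nonneg _, (hk d).trans_eq ?_⟩⟩
  rw [bound, Polynomial.aeval_def, Polynomial.hom_eval₂, Polynomial.eval, MvPolynomial.eval_X]
  congr 1
  ext a
  simp

end PolyBdd

/-! ### The sample complexity -/

/-- A sufficient sample size for the end-to-end class of a class of VC dimension `k`. -/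
noncomputable def sampleSize (k T : ℕ) (ε δ : ℝ) : ℕ :=
  ⌈(16 + 8 * Real.log (1 / δ)) / ε + 512 * k ^ 2 * T / ε ^ 2⌉₊

/-- The number `a` must be small enough for the ghost sample to hit `a` times and large enough for
`2^a` to beat the union bound; `a` close to `m * ε / 2` does both. The two terms of the sample size
each contribute a share `m * ε / 8` to the final estimate: the first pays for `log (1/δ)` and the
constants, the second for the number of traces. -/
theorem exists_hits_bound {k T m : ℕ} {ε δ : ℝ} (hε : 0 < ε) (hε1 : ε < 1) (hδ : 0 < δ)
    (hδ1 : δ < 1)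
    (hm : (16 + 8 * Real.log (1 / δ)) / ε + 512 * k ^ 2 * T / ε ^ 2 ≤ (m : ℝ)) :
    ∃ a : ℕ, 2 ^ a * (1 - ε / 2) ^ m ≤ 1 / 2 ∧
      2 * ((2 * m * T + 1) ^ k : ℕ) / 2 ^ a ≤ δ := by
  have hΛ : 0 ≤ Real.log (1 / δ) := Real.log_nonneg (one_le_one_div hδ hδ1.le)
  have hA : 0 ≤ (16 + 8 * Real.log (1 / δ)) / ε := by positivity
  have hB : 0 ≤ 512 * (k : ℝ) ^ 2 * T / ε ^ 2 := by positivity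
  have h1 : 16 + 8 * Real.log (1 / δ) ≤ m * ε := (div_le_iff₀ hε).1 (by linarith)
  have h2 : 512 * (k : ℝ) ^ 2 * T ≤ m * ε ^ 2 := (div_le_iff₀ (by positivity)).1 (by linarith)
  set s := Real.sqrt (2 * m * T)
  have hs0 : 0 ≤ s := Real.sqrt_nonneg _
  have hs : s ^ 2 = 2 * m * T := Real.sq_sqrt (by positivity)
  have h3 : 16 * k * s ≤ m * ε := by
    refine abs_le_of_sq_le_sq' ?_ (by positivity) |>.2
    calc (16 * (k : ℝ) * s) ^ 2 = (512 * k ^ 2 * T) * m := by rw [mul_pow, hs]; ring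
      _ ≤ (m * ε ^ 2) * m := by gcongr
      _ = (m * ε) ^ 2 := by ring
  -- Trading the logarithm for a square root avoids solving an inequality with `m` on both sides of
  -- a logarithm. The price is a sample size of order `k ^ 2 * T / ε ^ 2`.
  have h4 : Real.log (2 * m * T + 1) ≤ 2 * s := by
    have h5 : Real.log (1 + s) ≤ s := by
      have := Real.log_le_sub_one_of_pos (x := 1 + s) (by positivity)
      linarith
    calc Real.log (2 * m * T + 1) ≤ Real.log ((1 + s) ^ 2) := by
          apply Real.log_le_log (by positivity)
          rw [← hs]; nlinarith
      _ = 2 * Real.log (1 + s) := by rw [Real.log_pow]; norm_num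
      _ ≤ _ := by linarith
  -- One below the floor: the spare factor `2` yields the bound `1 / 2`, instead of `1`, in the
  -- first inequality.
  obtain ⟨a, ha⟩ : ∃ a : ℕ, ⌊m * ε / 2⌋₊ = a + 1 :=
    Nat.exists_eq_succ_of_ne_zero (Nat.floor_pos.2 (by linarith)).ne'
  have ha1 : (a : ℝ) + 1 ≤ m * ε / 2 := by
    have := Nat.floor_le (a := m * ε / 2) (by positivity)
    rw [ha] at this
    exact_mod_cast this
  have ha2 : m * ε / 2 < a + 2 := by
    have := Nat.lt_floor_add_one (m * ε / 2)
    rw [ha] at this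
    push_cast at this
    linarith
  refine ⟨a, ?_, ?_⟩
  · have h5 : (1 - ε / 2) ^ m ≤ Real.exp (-(m * ε / 2)) := by
      calc (1 - ε / 2) ^ m ≤ Real.exp (-(ε / 2)) ^ m := by
            have := Real.one_sub_le_exp_neg (ε / 2)
            gcongr
            linarith
        _ = _ := by rw [← Real.exp_nat_mul]; ring_nf
    have h6 : (2 : ℝ) ^ (a + 1) ≤ Real.exp (a + 1) := by
      calc (2 : ℝ) ^ (a + 1) ≤ Real.exp 1 ^ (a + 1) := by
            have := Real.add_one_le_exp 1
            gcongr
            linarith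
        _ = _ := by rw [← Real.exp_nat_mul]; push_cast; ring_nf
    have h7 : (2 : ℝ) ^ (a + 1) * (1 - ε / 2) ^ m ≤ 1 := by
      calc _ ≤ Real.exp (a + 1) * Real.exp (-(m * ε / 2)) := by
            have : 0 ≤ 1 - ε / 2 := by linarith
            gcongr
        _ = Real.exp (a + 1 - m * ε / 2) := by rw [← Real.exp_add]; ring_nf
        _ ≤ 1 := Real.exp_le_one_iff.2 (by linarith)
    rw [pow_succ] at h7
    linarith
  · rw [div_le_iff₀ (by positivity), ← Real.log_le_log_iff (by positivity) (by positivity),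
      Real.log_mul hδ.ne' (by positivity), Real.log_pow, Real.log_mul two_ne_zero (by positivity)]
    push_cast
    rw [Real.log_pow]
    have h5 : (k : ℝ) * Real.log (2 * m * T + 1) ≤ k * (2 * s) := by gcongr
    have h6 : Real.log δ = -Real.log (1 / δ) := by rw [one_div, Real.log_inv, neg_neg]
    have h7 := Real.log_two_lt_d9
    have h8 : (a : ℝ) * (1 / 2) ≤ a * Real.log 2 := by
      have := Real.log_two_gt_d9
      gcongr
      linarith
    rw [h6]
    linarith

theorem polyBdd_sampleSize {k : ℕ → ℕ} (hk : PolyBdd fun _ d _ _ _ => k d) :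
    PolyBdd fun _ d T ε δ => sampleSize (k d) T ε δ := by
  have h : PolyBdd fun _ d T ε δ =>
      (16 + 8 * Real.log (1 / δ)) * (1 / ε) + 512 * (k d : ℝ) ^ 2 * T * (1 / ε) ^ 2 + 1 :=
    ((((PolyBdd.const (by norm_num)).add ((PolyBdd.const (by norm_num)).mul .confidence)).mul
      .accuracy).add ((((PolyBdd.const (by norm_num)).mul (hk.pow 2)).mul .steps).mul
        (PolyBdd.accuracy.pow 2))).add (.const zero_le_one)
  refine h.mono fun n d T ε δ hT hε hε1 hδ hδ1 => ⟨Nat.cast_nonneg _, ?_⟩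
  have hΛ : 0 ≤ Real.log (1 / δ) := Real.log_nonneg (one_le_one_div hδ hδ1.le)
  refine (Nat.ceil_lt_add_one (by positivity)).le.trans_eq ?_
  field_simp

/-- Consistent rules learn the end-to-end class from Chain-of-Thought data. -/
theorem CoTLearns.of_consistent {H : Set Gen} {k : ℕ} (hk : vcDim H = k) (T : ℕ) (X : Set Str)
    (A : List Str → Gen) (hA : ∀ f ∈ H, ∀ xs : List Str, A (cotSample f T xs) ∈ H ∧
      ∀ x ∈ xs, ∀ j < T, A (cotSample f T xs) (cot f j x) = f (cot f j x)) :
    CoTLearns H T X (fun S => e2e (A S) T) (sampleSize k T) := by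
  intro D hD _ f hf ε δ hε hε1 hδ hδ1
  obtain ⟨a, ha, ha'⟩ := exists_hits_bound (k := k) (T := T) hε hε1 hδ hδ1 (Nat.le_ceil _)
  have key := (measure_exists_consistent_le D hk f T ha).trans ha'
  set μ := Measure.pi fun _ : Fin (sampleSize k T ε δ) => D
  set B := {x : Fin (sampleSize k T ε δ) → Str | ∃ h ∈ H,
    ε < D.real {y | e2e h T y ≠ e2e f T y} ∧ ∀ i, ∀ j < T, h (cot f j (x i)) = f (cot f j (x i))}
  have hB : 1 - δ ≤ μ.real Bᶜ := by
    rw [probReal_compl_eq_one_sub MeasurableSet.of_discrete]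
    exact sub_le_sub_left key 1
  refine (ENNReal.ofReal_le_ofReal hB).trans ?_
  rw [ofReal_measureReal]
  refine measure_mono fun x hx => ?_
  obtain ⟨hH, hcons⟩ := hA f hf (List.ofFn x)
  have hle : D.real {y | e2e (A (cotSample f T (List.ofFn x))) T y ≠ e2e f T y} ≤ ε := by
    by_contra hlt
    exact hx ⟨_, hH, not_le.1 hlt, fun i => hcons _ (List.mem_ofFn.2 ⟨i, rfl⟩)⟩
  exact (ENNReal.le_ofReal_iff_toReal_le (measure_ne_top _ _) hε.le).2 hle

/-! ### Explicit running-time bounds and their polynomial growth -/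

namespace PolyBdd

theorem natCast (c : ℕ) : PolyBdd fun _ _ _ _ _ => c := const (Nat.cast_nonneg c)

end PolyBdd

/-- A bound for the length of the examples extracted from `m` inputs of length at most `n`. -/
def examplesBound (n T m : ℕ) : ℕ := m * (T * (n + T + 1))

/-- A bound for the running time of a consistency solver on these examples. -/
def consBound (C c n d T m : ℕ) : ℕ := C * (1 + (examplesBound n T m + d)) ^ c

/-- A bound for the running time of the extraction. -/
def extractBound (n T m : ℕ) : ℕ :=
  m * (T * (23 * (n + T) + 25) + 7 * (n + T) + 6) + 2 * T + 4

/-- A bound for the size of the data handled during a prediction. -/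
def sizeBound (C c n d T m : ℕ) : ℕ := examplesBound n T m + consBound C c n d T m + d + n + T

/-- A bound for the time of an evaluation on data of size `M`. -/
def evalBound (C c M : ℕ) : ℕ := C * (1 + (M + M + M)) ^ c

/-- A bound for the running time of a prediction. -/
def generateBound (N M E T : ℕ) : ℕ :=
  T * (39 * M + 12 + E + N * (2 * (M + E + 1) + 1)) + 20 * M + 8

namespace PolyBdd

variable {m : ℕ → ℕ → ℕ → ℝ → ℝ → ℕ}

theorem examplesBound (hm : PolyBdd fun n d T ε δ => m n d T ε δ) :
    PolyBdd fun n d T ε δ => examplesBound n T (m n d T ε δ) := by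
  simpa [CoTLearning.examplesBound] using
    hm.mul (steps.mul ((length.add steps).add (natCast 1)))

theorem consBound (hm : PolyBdd fun n d T ε δ => m n d T ε δ) (C c : ℕ) :
    PolyBdd fun n d T ε δ => consBound C c n d T (m n d T ε δ) := by
  simpa [CoTLearning.consBound] using
    (natCast C).mul (((natCast 1).add (hm.examplesBound.add parameter)).pow c)

theorem extractBound (hm : PolyBdd fun n d T ε δ => m n d T ε δ) :
    PolyBdd fun n d T ε δ => extractBound n T (m n d T ε δ) := by
  have hL := length.add steps
  simpa [CoTLearning.extractBound] using
    ((hm.mul (((steps.mul (((natCast 23).mul hL).add (natCast 25))).add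
      ((natCast 7).mul hL)).add (natCast 6))).add ((natCast 2).mul steps)).add (natCast 4)

theorem sizeBound (hm : PolyBdd fun n d T ε δ => m n d T ε δ) (C c : ℕ) :
    PolyBdd fun n d T ε δ => sizeBound C c n d T (m n d T ε δ) := by
  simpa [CoTLearning.sizeBound] using
    (((hm.examplesBound.add (hm.consBound C c)).add parameter).add length).add steps

theorem evalBound (hm : PolyBdd fun n d T ε δ => m n d T ε δ) (C c : ℕ) :
    PolyBdd fun n d T ε δ => evalBound C c (m n d T ε δ) := by
  simpa [CoTLearning.evalBound] using
    (natCast C).mul (((natCast 1).add ((hm.add hm).add hm)).pow c)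

theorem generateBound {M E : ℕ → ℕ → ℕ → ℝ → ℝ → ℕ} (N : ℕ)
    (hM : PolyBdd fun n d T ε δ => M n d T ε δ) (hE : PolyBdd fun n d T ε δ => E n d T ε δ) :
    PolyBdd fun n d T ε δ => generateBound N (M n d T ε δ) (E n d T ε δ) T := by
  simpa [CoTLearning.generateBound] using
    ((steps.mul (((((natCast 39).mul hM).add (natCast 12)).add hE).add ((natCast N).mul
      (((natCast 2).mul ((hM.add hE).add (natCast 1))).add (natCast 1))))).add
        ((natCast 20).mul hM)).add (natCast 8)

end PolyBdd

end CoTLearning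

/-! ### Assembly of the learner and the predictor -/

theorem mainTheorem8 (F : ℕ → Set Gen) (ρ : ℕ → List Symb → Gen)
    (hCons : ConsInPolyTime F ρ) (hVC : VCPolyBounded F) :
    CoTLearnableInPolyTime F ρ := by
  obtain ⟨cons, pc, hcons⟩ := hCons
  obtain ⟨P, hP⟩ := hVC
  choose k hk hkP using hP
  obtain ⟨C, c, hC⟩ := exists_eval_two_le pc
  -- The rule is defined as what the solver outputs on the extracted examples. The default `[]` is
  -- used only on unrealizable samples, which no member of `F d` generates.
  have hw : ∀ (d T : ℕ) (S : List Str), ∃ w,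
      (∃ f ∈ F d, ∀ e ∈ nextTokenSample T S, f e.1 = e.2) →
      ρ d w ∈ F d ∧ (∀ e ∈ nextTokenSample T S, ρ d w e.1 = e.2) ∧
        cons.Outputs [encLabelled (nextTokenSample T S), encNat d] w
          (MvPolynomial.eval ![((encLabelled (nextTokenSample T S)).length : ℝ), (d : ℝ)] pc) := by
    intro d T S
    by_cases h : ∃ f ∈ F d, ∀ e ∈ nextTokenSample T S, f e.1 = e.2
    · obtain ⟨w, hw⟩ := hcons d _ h
      exact ⟨w, fun _ => hw⟩
    · exact ⟨[], fun h' => absurd h' h⟩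
  choose A hA using hw
  have hreal : ∀ (d T : ℕ), ∀ f ∈ F d, ∀ xs : List Str,
      ∃ g ∈ F d, ∀ e ∈ nextTokenSample T (cotSample f T xs), g e.1 = e.2 := by
    intro d T f hf xs
    refine ⟨f, hf, fun e he => ?_⟩
    obtain ⟨x, -, j, -, rfl⟩ := (mem_nextTokenSample f T xs e).1 he
    rfl
  set m : ℕ → ℕ → ℝ → ℝ → ℕ := fun d T => sampleSize (k d) T
  have hm : PolyBdd fun _ d T ε δ => m d T ε δ := polyBdd_sampleSize (PolyBdd.of_eval hkP)
  have hrun : ∀ (n d T : ℕ), ∀ f ∈ F d, ∀ xs : List Str, (∀ x ∈ xs, x.length ≤ n) →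
      ∃ t s, Run cons (load [encLabelled (nextTokenSample T (cotSample f T xs)), encNat d]) t s ∧
        s 0 = A d T (cotSample f T xs) ∧ t ≤ consBound C c n d T xs.length ∧
        (A d T (cotSample f T xs)).length ≤
          examplesBound n T xs.length + consBound C c n d T xs.length := by
    intro n d T f hf xs hxs
    obtain ⟨-, -, t, s, hr, hs, ht⟩ := hA d T _ (hreal d T f hf xs)
    have hlen : (encLabelled (nextTokenSample T (cotSample f T xs))).length ≤
        examplesBound n T xs.length := by
      have := length_encLabelled_nextTokenSample (T := T) (S := cotSample f T xs) (L := n + T) (by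
        intro z hz
        obtain ⟨x, hx, rfl⟩ := List.mem_map.1 hz
        rw [length_cot]
        have := hxs x hx
        omega)
      rwa [cotSample, List.length_map, ← cotSample] at this
    have ht' : t ≤ consBound C c n d T xs.length := by
      have h1 := ht.trans (hC _ _)
      rw [Nat.cast_le] at h1
      refine h1.trans ?_
      rw [consBound]
      gcongr
    refine ⟨t, s, hr, hs, ht', ?_⟩
    have h2 := hr.length_le 0
    rw [hs] at h2
    exact h2.trans (add_le_add hlen ht')
  -- The sum of sample size and training time, so that one polynomial bounds both.
  obtain ⟨p, hp⟩ := hm.add (hm.extractBound.add (hm.consBound C c))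
  refine ⟨.seq extract cons, A, m, p, ?_, ?_, ?_, ?_⟩
  · intro d T _ X
    refine CoTLearns.of_consistent (hk d) T X (fun S => ρ d (A d T S)) fun f hf xs => ?_
    obtain ⟨h1, h2, -⟩ := hA d T _ (hreal d T f hf xs)
    exact ⟨h1, fun x hx j hj => h2 _ ((mem_nextTokenSample f T xs _).2 ⟨x, hx, j, hj, rfl⟩)⟩
  · intro n d T ε δ hT hε hε1 hδ hδ1
    refine le_trans ?_ (hp n d T ε δ hT hε hε1 hδ hδ1).2
    exact le_add_of_nonneg_right (by positivity)
  · intro n d T ε δ hT hε hε1 hδ hδ1 f hf xs hlen hxs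
    refine ⟨(hA d T _ (hreal d T f hf xs)).1, ?_⟩
    obtain ⟨t, s, hr, hs, ht, -⟩ := hrun n d T f hf xs hxs
    obtain ⟨t', ht', hr'⟩ := exec_extract (encNat d) (T := T) (L := n + T) (S := cotSample f T xs)
      (by
        intro z hz
        obtain ⟨x, -, rfl⟩ := List.mem_map.1 hz
        rw [length_cot]
        omega)
      (by
        intro z hz
        obtain ⟨x, hx, rfl⟩ := List.mem_map.1 hz
        rw [length_cot]
        have := hxs x hx
        omega)
    refine ⟨_, s, hr'.seq hr, hs, le_trans ?_ (hp n d T ε δ hT hε hε1 hδ hδ1).2⟩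
    rw [cotSample, List.length_map] at ht'
    have h1 : t' + t ≤ extractBound n T xs.length + consBound C c n d T xs.length :=
      add_le_add ht' ht
    rw [hlen] at h1
    have h2 : ((t' + t : ℕ) : ℝ) ≤ _ := Nat.cast_le.2 h1
    rw [Nat.cast_add (extractBound _ _ _)] at h2
    exact h2.trans (le_add_of_nonneg_left (Nat.cast_nonneg _))
  · rintro ⟨ev, pe, hev⟩
    obtain ⟨C', c', hC'⟩ := exists_eval_three_le pe
    -- The protected block must lie above the four input stacks and all stacks of the evaluator.
    set N := max 4 ev.numStacks
    obtain ⟨q, hq⟩ := PolyBdd.generateBound N (hm.sizeBound C c) ((hm.sizeBound C c).evalBound C' c')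
    refine ⟨generate ev N, q, fun n d T ε δ hT hε hε1 hδ hδ1 f hf xs hlen hxs x hx => ?_⟩
    obtain ⟨-, -, -, -, -, hwlen⟩ := hrun n d T f hf xs hxs
    set w := A d T (cotSample f T xs)
    -- This dominates the description, `d` and every string of length at most `n + T` met during
    -- generation.
    set M := sizeBound C c n d T (m d T ε δ) with hM
    rw [hlen] at hwlen
    have hwM : w.length ≤ M := by rw [hM, sizeBound]; omega
    have hdM : d ≤ M := by rw [hM, sizeBound]; omega
    obtain ⟨s, ⟨t, ht, hr⟩, hs⟩ := exec_generate (h := ρ d w) (N := N) (ev := ev)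
      (E := evalBound C' c' M) (le_max_left _ _) (le_max_right _ _) hwM hdM (by
        intro u hu
        obtain ⟨t, s, hr, hs, ht⟩ := hev d w (hA d T _ (hreal d T f hf xs)).1 u
        refine ⟨s, t, ?_, hr, hs⟩
        have h1 := ht.trans (hC' _ _ _)
        rw [Nat.cast_le] at h1
        refine h1.trans ?_
        rw [evalBound]
        gcongr) hT (x := x) (by rw [hM, sizeBound]; omega)
    exact ⟨t, s, hr, hs, le_trans (Nat.cast_le.2 ht) (hq n d T ε δ hT hε hε1 hδ hδ1).2⟩
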